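/- Let $(M,\omega)$ be a compact smooth symplectic manifold without boundary, equipped with a smooth Riemannian metric $g$ compatible with $\omega$, that is, $\omega(u,v)=g(Ju,v)$ for an almost complex structure $J$ on $M$ ($J^2=-1$). For a smooth map $\varphi:M\to M$ let $$F(\varphi)=\frac12\int_M\|\varphi^*\omega\|^2\,d\mathrm{vol}_g ,$$ where $\|\alpha\|^2=\sum_{i<j}\alpha(e_i,e_j)^2$ for any $g$-orthonormal basis $(e_i)$ of the tangent space and $d\mathrm{vol}_g$ is the Riemannian volume measure. Then the identity map of $M$ minimizes $F$ in its homotopy class: $F(\mathrm{id}_M)\le F(\psi)$ for every smooth map $\psi:M\to M$ homotopic to $\mathrm{id}_M$. More generally, every symplectomorphism of $M$, i.e. every diffeomorphism $\varphi:M\to M$ with $\varphi^*\omega=\omega$, satisfies $F(\varphi)\le F(\psi)$ for every smooth map $\psi:M\to M$ homotopic to $\varphi$. -/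

import Mathlib

open Bundle
open scoped Manifold ContDiff

noncomputable section

namespace SymplecticEnergy

/-- A (not necessarily continuous) differential `k`-form on the boundaryless `m`-manifold `M`. -/
abbrev FormField (m k : ℕ) (M : Type*) [TopologicalSpace M]
    [ChartedSpace (EuclideanSpace ℝ (Fin m)) M] : Type _ :=
  (x : M) → (TangentSpace (𝓡 m) x) [⋀^Fin k]→L[ℝ] ℝ

/-- The pullback `φ^*α`: `(φ^*α)_x (v₁, …, v_k) = α_{φ x} (dφ v₁, …, dφ v_k)`. -/
def formPullback {m n k : ℕ} {M : Type*} [TopologicalSpace M]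
    [ChartedSpace (EuclideanSpace ℝ (Fin m)) M] {N : Type*} [TopologicalSpace N]
    [ChartedSpace (EuclideanSpace ℝ (Fin n)) N] (φ : M → N) (α : FormField n k N) :
    FormField m k M :=
  fun x => (α (φ x)).compContinuousLinearMap (mfderiv (𝓡 m) (𝓡 n) φ x)

/-- The coordinate expression of a form in the preferred chart at `x₀`, i.e. its pullback along
the inverse chart. It is meaningful on the (open) target of the chart. -/
def chartForm {m k : ℕ} {M : Type*} [TopologicalSpace M]
    [ChartedSpace (EuclideanSpace ℝ (Fin m)) M] (α : FormField m k M) (x₀ : M) :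
    EuclideanSpace ℝ (Fin m) → (EuclideanSpace ℝ (Fin m)) [⋀^Fin k]→L[ℝ] ℝ :=
  formPullback (extChartAt (𝓡 m) x₀).symm α

/-- The form is smooth: all its coordinate expressions are `C^∞`. -/
def IsSmoothForm {m k : ℕ} {M : Type*} [TopologicalSpace M]
    [ChartedSpace (EuclideanSpace ℝ (Fin m)) M] (α : FormField m k M) : Prop :=
  ∀ x₀ : M, ContDiffOn ℝ ∞ (chartForm α x₀) (extChartAt (𝓡 m) x₀).target

/-- The form is closed: the exterior derivative of each coordinate expression vanishes on the
domain of the coordinates. -/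
def IsClosedForm {m k : ℕ} {M : Type*} [TopologicalSpace M]
    [ChartedSpace (EuclideanSpace ℝ (Fin m)) M] (α : FormField m k M) : Prop :=
  ∀ x₀ : M, ∀ y ∈ (extChartAt (𝓡 m) x₀).target, extDeriv (chartForm α x₀) y = 0

/-- A symplectic form: a smooth, closed, pointwise nondegenerate 2-form. -/
structure SymplecticForm (m : ℕ) (M : Type*) [TopologicalSpace M]
    [ChartedSpace (EuclideanSpace ℝ (Fin m)) M] where
  form : FormField m 2 M
  smooth : IsSmoothForm form
  closed : IsClosedForm form
  nondegenerate : ∀ (x : M) (v : TangentSpace (𝓡 m) x),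
    (∀ w : TangentSpace (𝓡 m) x, form x ![v, w] = 0) → v = 0

section Riemannian

variable {m : ℕ} {M : Type*} [TopologicalSpace M] [ChartedSpace (EuclideanSpace ℝ (Fin m)) M]
  [RiemannianBundle (fun x : M => TangentSpace (𝓡 m) x)]

/-- The squared norm of a 2-form at a point, `∑_{i<j} α(e_i, e_j)²` for an orthonormal basis
`(e_i)` of the tangent space (the value does not depend on the orthonormal basis); written as
half of the sum over all pairs `(i, j)`. -/
def normSqTwoForm {x : M} (α : (TangentSpace (𝓡 m) x) [⋀^Fin 2]→L[ℝ] ℝ) : ℝ :=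
  letI : FiniteDimensional ℝ (TangentSpace (𝓡 m) x) :=
    inferInstanceAs (FiniteDimensional ℝ (EuclideanSpace ℝ (Fin m)))
  letI e := stdOrthonormalBasis ℝ (TangentSpace (𝓡 m) x)
  (1 / 2) * ∑ i, ∑ j, (α ![e i, e j]) ^ 2

/-- The coordinate vector field `∂_i` of the preferred chart at `x₀`, at the point of `M` with
coordinates `y`. -/
def coordVector (x₀ : M) (y : EuclideanSpace ℝ (Fin m)) (i : Fin m) :
    TangentSpace (𝓡 m) ((extChartAt (𝓡 m) x₀).symm y) :=
  mfderiv (𝓡 m) (𝓡 m) (extChartAt (𝓡 m) x₀).symm y (EuclideanSpace.single i (1 : ℝ))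

/-- The matrix `g_{ij} = g(∂_i, ∂_j)` of the metric in the preferred chart at `x₀`. -/
def metricMatrix (x₀ : M) (y : EuclideanSpace ℝ (Fin m)) : Matrix (Fin m) (Fin m) ℝ :=
  Matrix.of fun i j => inner ℝ (coordVector x₀ y i) (coordVector x₀ y j)

variable [MeasurableSpace M]

/-- The Riemannian volume of the domain of the preferred chart at `x₀`: the measure
`√(det g_{ij}) dy` on the coordinate domain, transported to `M`. -/
def chartVolume (x₀ : M) : MeasureTheory.Measure M :=
  ((MeasureTheory.volume.restrict (extChartAt (𝓡 m) x₀).target).withDensity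
    fun y => ENNReal.ofReal (Real.sqrt (metricMatrix x₀ y).det)).map (extChartAt (𝓡 m) x₀).symm

variable (m M) in
/-- The Riemannian volume measure of `M`. The measures `chartVolume x₀` agree on the overlaps of
the chart domains, and their supremum in the lattice of measures is the measure that restricts to
`chartVolume x₀` on the domain of each chart. -/
def riemannianVolume : MeasureTheory.Measure M := ⨆ x₀ : M, chartVolume (m := m) x₀

/-- The symplectic Dirichlet energy `F(φ) = ½ ∫_M ‖φ^*σ‖² dvol_g` of a map from the Riemannian
manifold `M` to the symplectic manifold `(N, σ)`. -/
def energy {n : ℕ} {N : Type*} [TopologicalSpace N] [ChartedSpace (EuclideanSpace ℝ (Fin n)) N]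
    (σ : SymplecticForm n N) (φ : M → N) : ℝ :=
  (1 / 2) * ∫ x, normSqTwoForm (formPullback (m := m) φ σ.form x) ∂(riemannianVolume m M)

/-- The smooth map `φ` minimizes `F` among all smooth maps homotopic to it. -/
def MinimizesInHomotopyClass {n : ℕ} {N : Type*} [TopologicalSpace N]
    [ChartedSpace (EuclideanSpace ℝ (Fin n)) N] (σ : SymplecticForm n N)
    (φ : C^∞⟮𝓡 m, M; 𝓡 n, N⟯) : Prop :=
  ∀ ψ : C^∞⟮𝓡 m, M; 𝓡 n, N⟯,
    ContinuousMap.Homotopic (φ : C(M, N)) (ψ : C(M, N)) → energy (m := m) σ φ ≤ energy (m := m) σ ψ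

end Riemannian

/-- The metric of `M` is compatible with `σ`: `σ(u, v) = g(J u, v)` for an almost complex
structure `J`. (Such a `J` is determined by `g` and `σ`, hence is automatically smooth.) -/
def IsCompatible {m : ℕ} {M : Type*} [TopologicalSpace M]
    [ChartedSpace (EuclideanSpace ℝ (Fin m)) M]
    [RiemannianBundle (fun x : M => TangentSpace (𝓡 m) x)] (σ : SymplecticForm m M) : Prop :=
  ∃ J : (x : M) → TangentSpace (𝓡 m) x →L[ℝ] TangentSpace (𝓡 m) x,
    (∀ x v, J x (J x v) = -v) ∧ ∀ x u v, σ.form x ![u, v] = inner ℝ (J x u) v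

/-- The diffeomorphism `φ` of `M` is a symplectomorphism of `(M, σ)`: `φ^*σ = σ`. -/
def IsSymplectomorphism {m : ℕ} {M : Type*} [TopologicalSpace M]
    [ChartedSpace (EuclideanSpace ℝ (Fin m)) M] (σ : SymplecticForm m M)
    (φ : M ≃ₘ^∞⟮𝓡 m, 𝓡 m⟯ M) : Prop :=
  formPullback (m := m) φ σ.form = σ.form

end SymplecticEnergy

end

/-! The argument is a calibration. Let P(f) be the integral of the pointwise inner product ⟨f^*σ, σ⟩
(`pairing`). Integrating |f^*σ - σ|² ≥ 0 gives 2P(f) - ∫|σ|² ≤ ∫|f^*σ|², with equality if f^*σ = σ.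
So it suffices that P is a homotopy invariant: then ∫|φ^*σ|² = ∫|σ|² = 2P(ψ) - ∫|σ|² ≤ ∫|ψ^*σ|² for
ψ homotopic to φ.

Invariance holds because f^*σ changes by an exact form while σ is coclosed for a compatible metric.
Both facts are used only locally. In a chart where σ has matrix w, compatibility gives ⟨α, σ⟩ = ½
tr(α w⁻¹) and √det g = √|det w|, so the metric drops out; dw = 0 then says that √|det w| w⁻¹ is
divergence free (`sum_inverse_derivative_eq_zero`), and ⟨dβ, σ⟩ integrates to zero for β compactly
supported (`setIntegral_trace_curl_mul_inv_eq_zero`).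

If two smooth maps agree off a compact subset K of a chart and both send K into one coordinate ball,
a Poincaré primitive of σ on the ball provides such a β, so P agrees on them
(`pairing_eq_of_eqOn_compl`). Nearby smooth maps are joined by finitely many such moves
(`exists_nhds_pairing_eq`). Since smooth maps are dense, P induces a locally constant function on
`C(M, M)`, and a merely continuous homotopy is a path there (`pairing_eq_of_homotopic`). -/

noncomputable section

set_option synthInstance.maxHeartbeats 200000

namespace SymplecticEnergy

/-! ### Linear algebra of 2-forms, Gram matrices and compatible complex structures. -/

section LinearAlgebra

theorem twoForm_swap {E : Type*} [AddCommGroup E] [Module ℝ E] [TopologicalSpace E]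
    (α : E [⋀^Fin 2]→L[ℝ] ℝ) (u v : E) : α ![u, v] = -α ![v, u] := by
  have := α.toAlternatingMap.map_swap ![v, u] (i := 0) (j := 1) (by decide)
  have e : ![v, u] ∘ (Equiv.swap (0 : Fin 2) 1) = ![u, v] := by
    ext k; fin_cases k <;> simp
  rw [e] at this
  exact this

/-- A 2-form as a bilinear form. -/
def twoFormBilin {E : Type*} [AddCommGroup E] [Module ℝ E] [TopologicalSpace E]
    (α : E [⋀^Fin 2]→L[ℝ] ℝ) : LinearMap.BilinForm ℝ E :=
  have ha : ∀ u u' v, α ![u + u', v] = α ![u, v] + α ![u', v] := fun u u' v =>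
    α.toMultilinearMap.cons_add ![v] u u'
  have hs : ∀ (c : ℝ) (u v), α ![c • u, v] = c • α ![u, v] := fun c u v =>
    α.toMultilinearMap.cons_smul ![v] c u
  LinearMap.mk₂ ℝ (fun u v => α ![u, v]) ha hs
    (fun u v v' => by rw [twoForm_swap, ha, twoForm_swap α v, twoForm_swap α v']; ring)
    (fun c u v => by rw [twoForm_swap, hs, twoForm_swap α v, smul_neg, neg_neg])

@[simp]
theorem twoFormBilin_apply {E : Type*} [AddCommGroup E] [Module ℝ E] [TopologicalSpace E]
    (α : E [⋀^Fin 2]→L[ℝ] ℝ) (u v : E) : twoFormBilin α u v = α ![u, v] := rfl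

/-- The matrix of a 2-form with respect to a family of vectors. -/
def twoFormMatrix {E ι : Type*} [AddCommGroup E] [Module ℝ E] [TopologicalSpace E]
    (α : E [⋀^Fin 2]→L[ℝ] ℝ) (b : ι → E) : Matrix ι ι ℝ :=
  Matrix.of fun i j => α ![b i, b j]

theorem twoFormMatrix_eq {E ι : Type*} [AddCommGroup E] [Module ℝ E] [TopologicalSpace E]
    [Fintype ι] [DecidableEq ι] (α : E [⋀^Fin 2]→L[ℝ] ℝ) (b : Module.Basis ι ℝ E) :
    twoFormMatrix α b = LinearMap.BilinForm.toMatrix b (twoFormBilin α) := by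
  ext i j
  simp [twoFormMatrix, LinearMap.BilinForm.toMatrix_apply]

theorem twoFormMatrix_change_basis {E ι κ : Type*} [AddCommGroup E] [Module ℝ E]
    [TopologicalSpace E] [Fintype ι] [DecidableEq ι] [Fintype κ] [DecidableEq κ]
    (α : E [⋀^Fin 2]→L[ℝ] ℝ) (b : Module.Basis ι ℝ E) (e : Module.Basis κ ℝ E) :
    twoFormMatrix α e =
      (b.toMatrix e).transpose * twoFormMatrix α b * b.toMatrix e := by
  rw [twoFormMatrix_eq, twoFormMatrix_eq, LinearMap.BilinForm.toMatrix_mul_basis_toMatrix]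

variable {V : Type*} [NormedAddCommGroup V] [InnerProductSpace ℝ V]

/-- The Gram matrix of a family of vectors. -/
def gramMatrix {ι : Type*} (b : ι → V) : Matrix ι ι ℝ := Matrix.of fun i j => inner ℝ (b i) (b j)

theorem gramMatrix_eq {ι κ : Type*} [Fintype κ] (b : Module.Basis ι ℝ V)
    (e : OrthonormalBasis κ ℝ V) :
    gramMatrix b = (e.toBasis.toMatrix b).transpose * e.toBasis.toMatrix b := by
  ext i j
  simp only [gramMatrix, Matrix.of_apply, Matrix.mul_apply, Matrix.transpose_apply,
    Module.Basis.toMatrix_apply, OrthonormalBasis.coe_toBasis_repr_apply]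
  rw [← e.repr.inner_map_map (b i) (b j), PiLp.inner_apply]
  simp [mul_comm]

variable {ι κ : Type*} [Fintype ι] [Fintype κ] [DecidableEq ι] [DecidableEq κ]

/-- With R the coordinates of `b` in `e` and P = R⁻¹, the Gram matrix is RᵀR, whose inverse is PPᵀ.
-/
theorem gramMatrix_mul_eq_one (b : Module.Basis ι ℝ V) (e : OrthonormalBasis κ ℝ V) :
    gramMatrix b * (b.toMatrix e * (b.toMatrix e).transpose) = 1 := by
  have h1 : e.toBasis.toMatrix b * b.toMatrix e = 1 := by
    simpa using e.toBasis.toMatrix_mul_toMatrix_flip b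
  have h2 : b.toMatrix e * e.toBasis.toMatrix b = 1 := by
    simpa using b.toMatrix_mul_toMatrix_flip e.toBasis
  rw [gramMatrix_eq b e]
  calc _ = (e.toBasis.toMatrix b).transpose * (e.toBasis.toMatrix b * b.toMatrix e) *
        (b.toMatrix e).transpose := by simp only [Matrix.mul_assoc]
    _ = (b.toMatrix e * e.toBasis.toMatrix b).transpose := by
        rw [h1, Matrix.mul_one, Matrix.transpose_mul]
    _ = 1 := by rw [h2, Matrix.transpose_one]

theorem gramMatrix_inv (b : Module.Basis ι ℝ V) (e : OrthonormalBasis κ ℝ V) :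
    (gramMatrix b)⁻¹ = b.toMatrix e * (b.toMatrix e).transpose :=
  Matrix.inv_eq_right_inv (gramMatrix_mul_eq_one b e)

theorem isUnit_det_gramMatrix [FiniteDimensional ℝ V] (b : Module.Basis ι ℝ V) :
    IsUnit (gramMatrix b).det :=
  (Matrix.isUnit_iff_isUnit_det _).1
    (.of_mul_eq_one _ (gramMatrix_mul_eq_one b (stdOrthonormalBasis ℝ V)))

/-- The inner product of two 2-forms, computed in an orthonormal basis, expressed through the
matrices of the forms and the Gram matrix of an arbitrary basis. -/
theorem half_sum_orthonormal_eq_trace (b : Module.Basis ι ℝ V) (e : OrthonormalBasis κ ℝ V)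
    (α β : V [⋀^Fin 2]→L[ℝ] ℝ) :
    (1 / 2 : ℝ) * ∑ i, ∑ j, α ![e i, e j] * β ![e i, e j] =
      (1 / 2) * (twoFormMatrix α b * (gramMatrix b)⁻¹ * (twoFormMatrix β b).transpose *
        (gramMatrix b)⁻¹).trace := by
  congr 1
  have h : ∑ i, ∑ j, α ![e i, e j] * β ![e i, e j] =
      (twoFormMatrix α e.toBasis * (twoFormMatrix β e.toBasis).transpose).trace := by
    simp [Matrix.trace, Matrix.mul_apply, twoFormMatrix]
  rw [h, twoFormMatrix_change_basis α b, twoFormMatrix_change_basis β b, gramMatrix_inv b e]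
  simp only [Matrix.transpose_mul, Matrix.transpose_transpose, OrthonormalBasis.coe_toBasis]
  simp only [Matrix.mul_assoc]
  rw [Matrix.trace_mul_comm]
  simp only [Matrix.mul_assoc]

/-- In an orthonormal basis the rows of the matrix of τ are the coordinates of J eᵢ. They are
orthonormal because J is an isometry, so the matrix is orthogonal; a change of basis gives the
general case. -/
theorem twoFormMatrix_compatible [FiniteDimensional ℝ V] (b : Module.Basis ι ℝ V)
    (τ : V [⋀^Fin 2]→L[ℝ] ℝ) (J : V → V) (hJ : ∀ v, J (J v) = -v)
    (hτ : ∀ u v, τ ![u, v] = inner ℝ (J u) v) :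
    twoFormMatrix τ b * (gramMatrix b)⁻¹ * (twoFormMatrix τ b).transpose = gramMatrix b := by
  set e := stdOrthonormalBasis ℝ V
  have hE : twoFormMatrix τ e.toBasis * (twoFormMatrix τ e.toBasis).transpose = 1 := by
    ext i k
    simp only [twoFormMatrix, Matrix.mul_apply, Matrix.transpose_apply, Matrix.of_apply, hτ,
      OrthonormalBasis.coe_toBasis]
    have : ∑ j, inner ℝ (J (e i)) (e j) * inner ℝ (J (e k)) (e j) =
        inner ℝ (J (e i)) (J (e k)) := by
      rw [← e.sum_inner_mul_inner]
      exact Finset.sum_congr rfl fun j _ => by rw [real_inner_comm (e j) (J (e k))]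
    -- J is an isometry: ⟨Ju, Jv⟩ = τ(u, Jv) = -τ(Jv, u) = -⟨J²v, u⟩ = ⟨v, u⟩.
    rw [this, ← hτ, twoForm_swap, hτ, hJ, inner_neg_left, neg_neg]
    rw [orthonormal_iff_ite.1 e.orthonormal, Matrix.one_apply]
    simp [eq_comm]
  have h1 : b.toMatrix e * e.toBasis.toMatrix b = 1 := by
    simpa using b.toMatrix_mul_toMatrix_flip e.toBasis
  have hG := gramMatrix_eq b e
  rw [gramMatrix_inv b e, hG]
  rw [twoFormMatrix_change_basis τ b e.toBasis] at hE
  simp only [OrthonormalBasis.coe_toBasis] at hE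
  set P := b.toMatrix e
  set R := e.toBasis.toMatrix b
  have h1' : R.transpose * P.transpose = 1 := by
    rw [← Matrix.transpose_mul, h1, Matrix.transpose_one]
  set W := twoFormMatrix τ b
  calc W * (P * P.transpose) * W.transpose
      = (R.transpose * P.transpose) * W * (P * P.transpose) * W.transpose * (P * R) := by
        rw [h1', h1, Matrix.one_mul, Matrix.mul_one]
    _ = R.transpose * ((P.transpose * W * P) * (P.transpose * W * P).transpose) * R := by
        simp only [Matrix.transpose_mul, Matrix.transpose_transpose, Matrix.mul_assoc]
    _ = R.transpose * R := by rw [hE, Matrix.mul_one]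

/-- Raising both indices of τ with the metric amounts to inverting its matrix; this removes the
metric from ⟨α, τ⟩. -/
theorem twoFormMatrix_inv_of_compatible [FiniteDimensional ℝ V] (b : Module.Basis ι ℝ V)
    (τ : V [⋀^Fin 2]→L[ℝ] ℝ) (J : V → V) (hJ : ∀ v, J (J v) = -v)
    (hτ : ∀ u v, τ ![u, v] = inner ℝ (J u) v) :
    (twoFormMatrix τ b)⁻¹ =
      (gramMatrix b)⁻¹ * (twoFormMatrix τ b).transpose * (gramMatrix b)⁻¹ := by
  refine Matrix.inv_eq_right_inv ?_
  rw [← Matrix.mul_assoc, ← Matrix.mul_assoc, twoFormMatrix_compatible b τ J hJ hτ,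
    Matrix.mul_nonsing_inv _ (isUnit_det_gramMatrix b)]

/-- Determinants in `twoFormMatrix_compatible` give (det W)² = (det G)², and det G ≥ 0. Hence the
Riemannian density depends on the form alone. -/
theorem det_gramMatrix_of_compatible [FiniteDimensional ℝ V] (b : Module.Basis ι ℝ V)
    (τ : V [⋀^Fin 2]→L[ℝ] ℝ) (J : V → V) (hJ : ∀ v, J (J v) = -v)
    (hτ : ∀ u v, τ ![u, v] = inner ℝ (J u) v) :
    (gramMatrix b).det = |(twoFormMatrix τ b).det| := by
  have hu := (isUnit_det_gramMatrix b).ne_zero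
  have h0 : 0 ≤ (gramMatrix b).det := by
    -- Reindexing by `ι` makes the transition matrix square, so that det G is the square of its
    -- determinant.
    have e : OrthonormalBasis ι ℝ V := (stdOrthonormalBasis ℝ V).reindex
      (Fintype.equivOfCardEq (by rw [Fintype.card_fin, Module.finrank_eq_card_basis b]))
    rw [gramMatrix_eq b e, Matrix.det_mul, Matrix.det_transpose]
    exact mul_self_nonneg _
  have h := congrArg Matrix.det (twoFormMatrix_compatible b τ J hJ hτ)
  rw [Matrix.det_mul, Matrix.det_mul, Matrix.det_transpose, Matrix.det_nonsing_inv,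
    Ring.inverse_eq_inv'] at h
  have h2 : (twoFormMatrix τ b).det ^ 2 = (gramMatrix b).det ^ 2 := by
    field_simp at h
    linarith
  rw [← abs_of_nonneg h0]
  exact ((sq_eq_sq_iff_abs_eq_abs _ _).1 h2).symm

end LinearAlgebra

/-! ### Derivatives of determinants and inverses, and coclosedness in coordinates. -/

section MatrixCalculus

open Matrix

variable {ι : Type*} [Fintype ι] [DecidableEq ι] {E : Type*} [NormedAddCommGroup E]
  [NormedSpace ℝ E]

theorem contDiffOn_det {w : E → Matrix ι ι ℝ} {U : Set E} {n : WithTop ℕ∞}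
    (hw : ∀ i j, ContDiffOn ℝ n (fun y => w y i j) U) :
    ContDiffOn ℝ n (fun y => (w y).det) U := by
  simp only [Matrix.det_apply]
  refine ContDiffOn.sum fun σ _ => ContDiffOn.const_smul _ ?_
  exact contDiffOn_prod fun i _ => hw _ _

/-- Cramer's rule. The case n = 0 serves for metric coefficients, of which only continuity is used.
-/
theorem contDiffOn_inv {w : E → Matrix ι ι ℝ} {U : Set E} {n : WithTop ℕ∞}
    (hw : ∀ i j, ContDiffOn ℝ n (fun y => w y i j) U) (h0 : ∀ y ∈ U, (w y).det ≠ 0) (i j : ι) :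
    ContDiffOn ℝ n (fun y => (w y)⁻¹ i j) U := by
  simp only [Matrix.inv_def, Ring.inverse_eq_inv', Matrix.smul_apply, smul_eq_mul]
  refine ((contDiffOn_det hw).inv h0).mul ?_
  simp only [Matrix.adjugate_apply]
  refine contDiffOn_det fun k l => ?_
  by_cases hk : k = j
  · subst hk
    simpa using contDiffOn_const
  · simpa [Matrix.updateRow_ne hk] using hw k l

theorem contDiffOn_sqrt_abs_det {w : E → Matrix ι ι ℝ} {U : Set E}
    (hw : ∀ i j, ContDiffOn ℝ 1 (fun y => w y i j) U) (h0 : ∀ y ∈ U, (w y).det ≠ 0) :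
    ContDiffOn ℝ 1 (fun y => Real.sqrt |(w y).det|) U := by
  refine ContDiffOn.sqrt ?_ fun y hy => abs_ne_zero.2 (h0 y hy)
  have h1 : ∀ x : ℝ, x ≠ 0 → ContDiffAt ℝ 1 (fun x : ℝ => |x|) x := fun x hx => by
    simpa using contDiffAt_abs (n := 1) hx
  exact fun y hy => ContDiffAt.comp_contDiffWithinAt (g := fun x : ℝ => |x|) y (h1 _ (h0 y hy))
    (contDiffOn_det hw y hy)

/-- Jacobi's formula for the derivative of a determinant. -/
theorem hasFDerivAt_det {w : E → Matrix ι ι ℝ} {w' : ι → ι → E →L[ℝ] ℝ} {y : E}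
    (hw : ∀ i j, HasFDerivAt (fun y => w y i j) (w' i j) y) :
    HasFDerivAt (fun y => (w y).det) (∑ i, ∑ j, (w y).adjugate j i • w' i j) y := by
  let f : ContinuousMultilinearMap ℝ (fun _ : ι => ι → ℝ) ℝ :=
    { (Matrix.detRowAlternating (n := ι) (R := ℝ)).toMultilinearMap with
      cont := by
        change Continuous fun M : ι → ι → ℝ => Matrix.det (M : Matrix ι ι ℝ)
        exact Continuous.matrix_det continuous_id }
  have hf : ∀ M : Matrix ι ι ℝ, f M = M.det := fun M => rfl
  have h1 : HasFDerivAt (fun y => (fun i j => w y i j : ι → ι → ℝ))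
      (ContinuousLinearMap.pi fun i => ContinuousLinearMap.pi fun j => w' i j) y :=
    hasFDerivAt_pi.2 fun i => hasFDerivAt_pi.2 fun j => hw i j
  have h2 := (f.hasFDerivAt (fun i j => w y i j)).comp y h1
  refine h2.congr_fderiv ?_
  ext v
  simp only [ContinuousLinearMap.comp_apply, ContinuousMultilinearMap.linearDeriv_apply,
    _root_.sum_apply, _root_.smul_apply, smul_eq_mul]
  refine Finset.sum_congr rfl fun i _ => ?_
  have : f (Function.update (fun i j => w y i j) i (fun j => w' i j v)) =
      ((w y).updateRow i (fun j => w' i j v)).det := rfl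
  refine Eq.trans this ?_
  -- Expansion along row `i`, whose cofactors do not see the replaced row.
  rw [Matrix.det_eq_sum_mul_adjugate_row _ i]
  refine Finset.sum_congr rfl fun j _ => ?_
  rw [Matrix.updateRow_self, Matrix.adjugate_apply, Matrix.adjugate_apply,
    Matrix.updateRow_idem, mul_comm]

/-- Differentiating w⁻¹w = 1 gives (w⁻¹)' = -w⁻¹w'w⁻¹. -/
theorem fderiv_inv_apply {w : E → Matrix ι ι ℝ} {U : Set E} (hU : IsOpen U)
    (hw : ∀ i j, ContDiffOn ℝ 1 (fun y => w y i j) U) (h0 : ∀ y ∈ U, (w y).det ≠ 0)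
    {y : E} (hy : y ∈ U) (v : E) (i j : ι) :
    fderiv ℝ (fun y => (w y)⁻¹ i j) y v =
      -∑ a, ∑ b, (w y)⁻¹ i a * fderiv ℝ (fun y => w y a b) y v * (w y)⁻¹ b j := by
  set A' : Matrix ι ι ℝ := Matrix.of fun i j => fderiv ℝ (fun y => (w y)⁻¹ i j) y v
  set W' : Matrix ι ι ℝ := Matrix.of fun i j => fderiv ℝ (fun y => w y i j) y v
  have hU' := hU.mem_nhds hy
  have dw : ∀ i j, DifferentiableAt ℝ (fun y => w y i j) y := fun i j =>
    ((hw i j).contDiffAt hU').differentiableAt one_ne_zero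
  have dA : ∀ i j, DifferentiableAt ℝ (fun y => (w y)⁻¹ i j) y := fun i j =>
    ((contDiffOn_inv hw h0 i j).contDiffAt hU').differentiableAt one_ne_zero
  have key : A' * w y + (w y)⁻¹ * W' = 0 := by
    ext i j
    have h1 : (fun y => ∑ k, (w y)⁻¹ i k * w y k j) =ᶠ[nhds y]
        fun _ => (1 : Matrix ι ι ℝ) i j := by
      filter_upwards [hU'] with z hz
      rw [← Matrix.mul_apply, Matrix.nonsing_inv_mul _ (isUnit_iff_ne_zero.2 (h0 z hz))]
    have h2 := h1.fderiv_eq (𝕜 := ℝ)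
    have hm : ∀ k ∈ Finset.univ, DifferentiableAt ℝ (fun y => (w y)⁻¹ i k * w y k j) y :=
      fun k _ => (dA i k).mul (dw k j)
    rw [fderiv_fun_sum hm] at h2
    have hp : ∀ k, fderiv ℝ (fun y => (w y)⁻¹ i k * w y k j) y =
        (w y)⁻¹ i k • fderiv ℝ (fun y => w y k j) y +
          w y k j • fderiv ℝ (fun y => (w y)⁻¹ i k) y :=
      fun k => fderiv_fun_mul (dA i k) (dw k j)
    have h3 := congrArg (fun L : E →L[ℝ] ℝ => L v) h2
    simp only [hp, _root_.sum_apply, _root_.add_apply, _root_.smul_apply, smul_eq_mul] at h3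
    simp only [Matrix.add_apply, Matrix.mul_apply, A', W', Matrix.of_apply, Matrix.zero_apply,
      ← Finset.sum_add_distrib]
    refine Eq.trans (Finset.sum_congr rfl fun k _ => ?_) (h3.trans (by simp))
    ring
  have h4 : A' = -((w y)⁻¹ * W' * (w y)⁻¹) := by
    have := congrArg (· * (w y)⁻¹) key
    simp only [Matrix.add_mul, Matrix.zero_mul, Matrix.mul_assoc,
      Matrix.mul_nonsing_inv _ (isUnit_iff_ne_zero.2 (h0 y hy)), Matrix.mul_one] at this
    rw [Matrix.mul_assoc]
    exact eq_neg_of_add_eq_zero_left this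
  have h5 := congrFun (congrFun h4 i) j
  simp only [A', W', Matrix.of_apply, Matrix.neg_apply, Matrix.mul_apply] at h5
  rw [h5, Finset.sum_comm]
  simp only [Finset.sum_mul]

/-- Jacobi's formula; the sign from the derivative of the absolute value cancels the sign of the
determinant. -/
theorem fderiv_sqrt_abs_det_apply {w : E → Matrix ι ι ℝ} {y : E}
    (hw : ∀ i j, DifferentiableAt ℝ (fun y => w y i j) y) (h0 : (w y).det ≠ 0) (v : E) :
    fderiv ℝ (fun y => Real.sqrt |(w y).det|) y v =
      Real.sqrt |(w y).det| *
        ((1 / 2) * ∑ a, ∑ b, (w y)⁻¹ a b * fderiv ℝ (fun y => w y b a) y v) := by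
  have h1 := hasFDerivAt_det fun i j => (hw i j).hasFDerivAt
  have h2 := (h1.abs h0).sqrt (abs_ne_zero.2 h0)
  rw [h2.fderiv]
  simp only [_root_.smul_apply, _root_.sum_apply, smul_eq_mul,
    Matrix.inv_def, Ring.inverse_eq_inv', Matrix.smul_apply]
  rw [Finset.sum_comm]
  simp only [mul_assoc, ← Finset.mul_sum]
  set S := ∑ a, ∑ b, (w y).adjugate a b * (fderiv ℝ (fun y => w y b a) y) v
  have hp : 0 < |(w y).det| := abs_pos.2 h0
  have hs : Real.sqrt |(w y).det| * Real.sqrt |(w y).det| = |(w y).det| :=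
    Real.mul_self_sqrt hp.le
  have hs0 : Real.sqrt |(w y).det| ≠ 0 := (Real.sqrt_pos.2 hp).ne'
  have hd : (SignType.sign (w y).det : ℝ) = |(w y).det| / (w y).det := by
    rw [eq_div_iff h0, sign_mul_self]
  rw [hd]
  generalize Real.sqrt |(w y).det| = s at hs hs0 ⊢
  rw [← hs]
  field_simp

/-- The algebraic identity behind the coclosedness of a symplectic form with respect to a
compatible metric. -/
theorem sum_inverse_derivative_eq_zero {ι : Type*} [Fintype ι] (A : Matrix ι ι ℝ)
    (hA : ∀ i j, A i j = -A j i)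
    (d : ι → ι → ι → ℝ) (hd : ∀ k i j, d k i j = -d k j i)
    (hc : ∀ i j k, d i j k + d j k i + d k i j = 0) (j : ι) :
    ∑ i, ((1 / 2) * (∑ a, ∑ b, A a b * d i b a) * A j i -
      ∑ a, ∑ b, A j a * d i a b * A b i) = 0 := by
  -- The closedness relation is contracted with A_{ja}A_{bi}. By antisymmetry the first and third of
  -- the resulting sums coincide (`h3`), so 2S + T = 0, with T the second sum relabelled (`h2`); the
  -- claim is -T/2 - S = 0.
  have h0 : ∑ i, ∑ a, ∑ b, A j a * A b i * (d i a b + d a b i + d b i a) = 0 :=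
    Finset.sum_eq_zero fun i _ => Finset.sum_eq_zero fun a _ => Finset.sum_eq_zero fun b _ => by
      rw [hc, mul_zero]
  have h3 : ∑ i, ∑ a, ∑ b, A j a * A b i * d b i a = ∑ i, ∑ a, ∑ b, A j a * A b i * d i a b := by
    have e1 : ∀ i, ∑ a, ∑ b, A j a * A b i * d b i a = ∑ b, ∑ a, A j a * A b i * d b i a :=
      fun i => Finset.sum_comm
    simp only [e1]
    rw [Finset.sum_comm]
    refine Finset.sum_congr rfl fun i _ => ?_
    rw [Finset.sum_comm]
    refine Finset.sum_congr rfl fun a _ => Finset.sum_congr rfl fun b _ => ?_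
    rw [hA i b, hd i b a]; ring
  have h2 : ∑ i, ∑ a, ∑ b, A j a * A b i * d a b i = ∑ i, ∑ a, ∑ b, A j i * A a b * d i a b := by
    rw [Finset.sum_comm]
    refine Finset.sum_congr rfl fun i _ => ?_
    rw [Finset.sum_comm]
  simp only [mul_add, Finset.sum_add_distrib] at h0
  rw [h3, h2] at h0
  rw [Finset.sum_sub_distrib]
  have e1 : ∑ i, (1 / 2) * (∑ a, ∑ b, A a b * d i b a) * A j i =
      -(1 / 2) * ∑ i, ∑ a, ∑ b, A j i * A a b * d i a b := by
    rw [Finset.mul_sum]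
    refine Finset.sum_congr rfl fun i _ => ?_
    simp only [Finset.mul_sum, Finset.sum_mul]
    refine Finset.sum_congr rfl fun a _ => Finset.sum_congr rfl fun b _ => ?_
    rw [hd i b a]; ring
  have e2 : ∑ i, ∑ a, ∑ b, A j a * d i a b * A b i = ∑ i, ∑ a, ∑ b, A j a * A b i * d i a b :=
    Finset.sum_congr rfl fun i _ => Finset.sum_congr rfl fun a _ =>
      Finset.sum_congr rfl fun b _ => by ring
  rw [e1, e2]
  linarith

end MatrixCalculus

/-! ### Derivatives of compactly supported functions integrate to zero. -/

section Divergence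

open MeasureTheory

variable {E : Type*} [NormedAddCommGroup E] [NormedSpace ℝ E] [FiniteDimensional ℝ E]
  [MeasurableSpace E] [BorelSpace E] {μ : Measure E} [μ.IsAddHaarMeasure]

/-- Integration by parts against the constant function 1. -/
theorem integral_fderiv_eq_zero_of_hasCompactSupport {g : E → ℝ} (hg : ContDiff ℝ 1 g)
    (hc : HasCompactSupport g) (v : E) : ∫ x, fderiv ℝ g x v ∂μ = 0 := by
  have hd : Continuous fun x => fderiv ℝ g x v :=
    (hg.continuous_fderiv one_ne_zero).clm_apply continuous_const
  have hdc : HasCompactSupport fun x => fderiv ℝ g x v := hc.fderiv_apply ℝ v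
  have := integral_mul_fderiv_eq_neg_fderiv_mul_of_integrable (μ := μ) (f := fun _ : E => (1 : ℝ))
    (g := g) (v := v) (by simp) (by simpa using hd.integrable_of_hasCompactSupport hdc)
    (by simpa using hg.continuous.integrable_of_hasCompactSupport hc) (by simp)
    (fun x _ => hg.differentiable one_ne_zero x)
  simpa using this

/-- Extension by zero outside `U` is C¹ on the whole space, since `g` vanishes on `U` off the
compact set `K`. -/
theorem setIntegral_fderiv_eq_zero {g : E → ℝ} {U K : Set E} (hU : IsOpen U) (hK : IsCompact K)
    (hKU : K ⊆ U) (hg : ContDiffOn ℝ 1 g U) (h0 : ∀ x ∈ U, x ∉ K → g x = 0) (v : E) :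
    IntegrableOn (fun x => fderiv ℝ g x v) U μ ∧ ∫ x in U, fderiv ℝ g x v ∂μ = 0 := by
  classical
  set G : E → ℝ := U.indicator g
  have hG0 : ∀ x ∉ K, G =ᶠ[nhds x] 0 := fun x hx => by
    filter_upwards [hK.isClosed.isOpen_compl.mem_nhds hx] with z hz
    by_cases hzU : z ∈ U
    · simp [G, hzU, h0 z hzU hz]
    · simp [G, hzU]
  have hGU : ∀ x ∈ U, G =ᶠ[nhds x] g := fun x hx => by
    filter_upwards [hU.mem_nhds hx] with z hz
    simp [G, hz]
  have hG : ContDiff ℝ 1 G := by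
    refine contDiff_iff_contDiffAt.2 fun x => ?_
    by_cases hx : x ∈ K
    · exact (hg.contDiffAt (hU.mem_nhds (hKU hx))).congr_of_eventuallyEq (hGU x (hKU hx))
    · exact contDiffAt_const.congr_of_eventuallyEq (hG0 x hx)
  have hGc : HasCompactSupport G := HasCompactSupport.intro hK fun x hx => (hG0 x hx).eq_of_nhds
  have hd : Continuous fun x => fderiv ℝ G x v :=
    (hG.continuous_fderiv one_ne_zero).clm_apply continuous_const
  have hint : Integrable (fun x => fderiv ℝ G x v) μ :=
    hd.integrable_of_hasCompactSupport (hGc.fderiv_apply ℝ v)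
  have heq : Set.EqOn (fun x => fderiv ℝ G x v) (fun x => fderiv ℝ g x v) U := fun x hx => by
    simp only [(hGU x hx).fderiv_eq]
  constructor
  · exact hint.integrableOn.congr_fun heq hU.measurableSet
  · rw [← setIntegral_congr_fun hU.measurableSet heq,
      setIntegral_eq_integral_of_forall_compl_eq_zero,
      integral_fderiv_eq_zero_of_hasCompactSupport hG hGc]
    intro x hx
    rw [(hG0 x fun h => hx (hKU h)).fderiv_eq]
    simp

end Divergence

/-! ### The Poincaré lemma for 2-forms on a ball. -/

section Poincare

attribute [-instance] Bundle.instNormedAddCommGroupOfRiemannianBundleOfIsTopologicalAddGroupOfContinuousConstSMulReal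

open MeasureTheory Topology

variable {E G : Type*} [NormedAddCommGroup E] [NormedSpace ℝ E] [FiniteDimensional ℝ E]
  [NormedAddCommGroup G] [NormedSpace ℝ G]

theorem hasFDerivAt_intervalIntegral_of_contDiff {F : E × ℝ → G} (hF : ContDiff ℝ 1 F) (x : E) :
    HasFDerivAt (fun x => ∫ t in (0 : ℝ)..1, F (x, t))
      (∫ t in (0 : ℝ)..1, (fderiv ℝ F (x, t)).comp (.inl ℝ E ℝ)) x := by
  have hD : Continuous fun p : E × ℝ => (fderiv ℝ F p).comp (.inl ℝ E ℝ) :=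
    (hF.continuous_fderiv one_ne_zero).clm_comp continuous_const
  obtain ⟨C, hC⟩ := ((isCompact_closedBall x 1).prod
    (isCompact_Icc (a := (0 : ℝ)) (b := 1))).exists_bound_of_continuousOn
    hD.continuousOn
  refine intervalIntegral.hasFDerivAt_integral_of_dominated_of_fderiv_le
    (F' := fun x t => (fderiv ℝ F (x, t)).comp (.inl ℝ E ℝ)) (bound := fun _ => C)
    (Metric.closedBall_mem_nhds x one_pos) ?_ ?_ ?_ ?_ ?_ ?_
  · exact .of_forall fun y => (hF.continuous.comp (.prodMk_right y)).aestronglyMeasurable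
  · exact (hF.continuous.comp (.prodMk_right x)).intervalIntegrable _ _
  · exact (hD.comp (.prodMk_right x)).aestronglyMeasurable
  · refine .of_forall fun t ht y hy => hC (y, t) ⟨hy, ?_⟩
    rw [Set.uIoc_of_le zero_le_one] at ht
    exact ⟨ht.1.le, ht.2⟩
  · exact intervalIntegrable_const
  · refine .of_forall fun t ht y hy => ?_
    exact ((hF.differentiable one_ne_zero (y, t)).hasFDerivAt).comp y (hasFDerivAt_prodMk_left y t)

theorem contDiff_intervalIntegral {F : E × ℝ → G} (hF : ContDiff ℝ 1 F) :
    ContDiff ℝ 1 (fun x => ∫ t in (0 : ℝ)..1, F (x, t)) := by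
  refine contDiff_one_iff_hasFDerivAt.2 ⟨_, ?_, hasFDerivAt_intervalIntegral_of_contDiff hF⟩
  have hD : Continuous fun p : E × ℝ => (fderiv ℝ F p).comp (.inl ℝ E ℝ) :=
    (hF.continuous_fderiv one_ne_zero).clm_comp continuous_const
  exact intervalIntegral.continuous_parametric_intervalIntegral_of_continuous' (by exact hD) 0 1

/-- Multiplication by a bump function equal to 1 on the ball. A globally smooth form allows
differentiation under the integral of the radial homotopy with no domain conditions. -/
theorem exists_contDiff_eqOn_ball {f : E → G} {U : Set E} (hU : IsOpen U)
    (hf : ContDiffOn ℝ ∞ f U) {c : E} {r : ℝ} (hr : 0 < r) (hcr : Metric.closedBall c r ⊆ U) :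
    ∃ f' : E → G, ContDiff ℝ ∞ f' ∧ Set.EqOn f' f (Metric.ball c r) := by
  obtain ⟨R, hR, hRU⟩ := (isCompact_closedBall c r).exists_thickening_subset_open hU hcr
  let χ : ContDiffBump c := ⟨r, r + R / 2, hr, by linarith⟩
  have hsub : Metric.closedBall c (r + R / 2) ⊆ U := by
    intro z hz
    refine hRU ?_
    rw [thickening_closedBall hR hr.le]
    exact Metric.closedBall_subset_ball (by linarith) hz
  refine ⟨fun z => χ z • f z, ?_, fun z hz => ?_⟩
  · refine contDiff_iff_contDiffAt.2 fun z => ?_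
    by_cases hz : z ∈ tsupport χ
    · rw [χ.tsupport_eq] at hz
      exact χ.contDiff.contDiffAt.smul (hf.contDiffAt (hU.mem_nhds (hsub hz)))
    · refine contDiffAt_const (c := 0) |>.congr_of_eventuallyEq ?_
      filter_upwards [(isClosed_tsupport χ).isOpen_compl.mem_nhds hz] with w hw
      rw [image_eq_zero_of_notMem_tsupport hw, zero_smul]
  · simp only [χ.one_of_mem_closedBall (Metric.ball_subset_closedBall hz), one_smul]

/-- **Poincaré lemma** for 2-forms near a closed ball. -/
theorem exists_primitive_on_ball {B : E → E →L[ℝ] E →L[ℝ] ℝ} {U : Set E} (hU : IsOpen U)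
    (hB : ContDiffOn ℝ ∞ B U) (halt : ∀ y ∈ U, ∀ u v, B y u v = -B y v u)
    (hd : ∀ y ∈ U, ∀ u v w, fderiv ℝ B y u v w + fderiv ℝ B y v w u + fderiv ℝ B y w u v = 0)
    {c : E} {r : ℝ} (hr : 0 < r) (hcr : Metric.closedBall c r ⊆ U) :
    ∃ lam : E → E →L[ℝ] ℝ, ContDiff ℝ 1 lam ∧
      ∀ y ∈ Metric.ball c r, ∀ u v, fderiv ℝ lam y u v - fderiv ℝ lam y v u = B y u v := by
  obtain ⟨B', hB', hBeq⟩ := exists_contDiff_eqOn_ball hU hB hr hcr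
  have hsub : Metric.ball c r ⊆ U := Metric.ball_subset_closedBall.trans hcr
  have hfd : ∀ y ∈ Metric.ball c r, fderiv ℝ B' y = fderiv ℝ B y := fun y hy =>
    Filter.EventuallyEq.fderiv_eq (hBeq.eventuallyEq_of_mem (Metric.isOpen_ball.mem_nhds hy))
  -- Closedness, with the alternation of B used to put the first two slots in the order met below.
  have hd' : ∀ y ∈ Metric.ball c r, ∀ u v w,
      fderiv ℝ B' y u v w - fderiv ℝ B' y w v u = fderiv ℝ B' y v u w := fun y hy u v w => by
    have halt' : ∀ a b d, fderiv ℝ B y a b d = -fderiv ℝ B y a d b := by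
      intro a b d
      have hdB : HasFDerivAt B (fderiv ℝ B y) y :=
        ((hB.contDiffAt (hU.mem_nhds (hsub hy))).differentiableAt (by simp)).hasFDerivAt
      have h1 : HasFDerivAt (fun z => B z b d) _ y :=
        (hdB.clm_apply (hasFDerivAt_const b y)).clm_apply (hasFDerivAt_const d y)
      have h2 : HasFDerivAt (fun z => -B z d b) _ y :=
        ((hdB.clm_apply (hasFDerivAt_const d y)).clm_apply (hasFDerivAt_const b y)).neg
      have h3 : (fun z => B z b d) =ᶠ[𝓝 y] fun z => -B z d b := by
        filter_upwards [hU.mem_nhds (hsub hy)] with z hz using halt z hz b d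
      have h4 := congrArg (fun L : E →L[ℝ] ℝ => L a) ((h2.congr_of_eventuallyEq h3).unique h1)
      simpa using h4.symm
    rw [hfd y hy]
    have := hd y (hsub hy) u v w
    rw [halt' w v u, halt' v u w]
    linarith
  -- Radial homotopy operator: λ_y(v) = ∫₀¹ t B(c + t(y - c))(y - c, v) dt.
  let F : E × ℝ → E →L[ℝ] ℝ := fun p => p.2 • B' (c + p.2 • (p.1 - c)) (p.1 - c)
  have hF : ContDiff ℝ 1 F := by
    refine contDiff_snd.smul (ContDiff.clm_apply ?_ (contDiff_fst.sub contDiff_const))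
    exact (hB'.of_le (by simp)).comp
      (contDiff_const.add (contDiff_snd.smul (contDiff_fst.sub contDiff_const)))
  refine ⟨fun x => ∫ t in (0 : ℝ)..1, F (x, t), contDiff_intervalIntegral hF, fun y hy u v => ?_⟩
  rw [(hasFDerivAt_intervalIntegral_of_contDiff hF y).fderiv]
  have hD : Continuous fun p : E × ℝ => (fderiv ℝ F p).comp (.inl ℝ E ℝ) :=
    (hF.continuous_fderiv one_ne_zero).clm_comp continuous_const
  have hDy : Continuous fun t : ℝ => (fderiv ℝ F (y, t)).comp (.inl ℝ E ℝ) :=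
    hD.comp (.prodMk_right y)
  have hDu : ∀ u, Continuous fun t : ℝ => (fderiv ℝ F (y, t)).comp (.inl ℝ E ℝ) u := fun u =>
    hDy.clm_apply continuous_const
  have hDuv : ∀ u v, Continuous fun t : ℝ => (fderiv ℝ F (y, t)).comp (.inl ℝ E ℝ) u v :=
    fun u v => (hDu u).clm_apply continuous_const
  have hI : ∀ u v, (∫ t in (0 : ℝ)..1, (fderiv ℝ F (y, t)).comp (.inl ℝ E ℝ)) u v =
      ∫ t in (0 : ℝ)..1, (fderiv ℝ F (y, t)).comp (.inl ℝ E ℝ) u v := fun u v => by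
    rw [ContinuousLinearMap.intervalIntegral_apply (hDy.intervalIntegrable 0 1),
      ContinuousLinearMap.intervalIntegral_apply ((hDu u).intervalIntegrable 0 1)]
  rw [hI, hI,
    ← intervalIntegral.integral_sub ((hDuv u v).intervalIntegrable 0 1)
      ((hDuv v u).intervalIntegrable 0 1)]
  have hmem : ∀ t ∈ Set.Icc (0 : ℝ) 1, c + t • (y - c) ∈ Metric.ball c r := fun t ht => by
    rw [mem_ball_iff_norm, add_sub_cancel_left, norm_smul, Real.norm_of_nonneg ht.1]
    rw [mem_ball_iff_norm] at hy
    nlinarith [norm_nonneg (y - c), ht.2]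
  have hline : ∀ t, HasDerivAt (fun t : ℝ => c + t • (y - c)) (y - c) t := fun t => by
    simpa using ((hasDerivAt_id t).smul_const (y - c)).const_add c
  -- By closedness the integrand of dλ(u, v) is the t-derivative of t² B(c + t(y - c))(u, v), which
  -- takes the values 0 at t = 0 and B(y)(u, v) at t = 1.
  have hder : ∀ t, HasDerivAt (fun t : ℝ => t ^ 2 * B' (c + t • (y - c)) u v)
      (2 * t * B' (c + t • (y - c)) u v + t ^ 2 * fderiv ℝ B' (c + t • (y - c)) (y - c) u v) t := by
    intro t
    have h1 : HasDerivAt (fun t : ℝ => B' (c + t • (y - c)))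
        (fderiv ℝ B' (c + t • (y - c)) (y - c)) t :=
      ((hB'.differentiable (by simp) _).hasFDerivAt).comp_hasDerivAt t (hline t)
    have h2 := (h1.clm_apply (hasDerivAt_const t u)).clm_apply (hasDerivAt_const t v)
    refine ((hasDerivAt_pow 2 t).mul h2).congr_deriv ?_
    simp
  have hDt : ∀ t u v, (fderiv ℝ F (y, t)).comp (.inl ℝ E ℝ) u v =
      t ^ 2 * fderiv ℝ B' (c + t • (y - c)) u (y - c) v + t * B' (c + t • (y - c)) u v := by
    intro t u v
    have hA : HasFDerivAt (fun x : E => c + t • (x - c)) (t • ContinuousLinearMap.id ℝ E) y :=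
      (((hasFDerivAt_id y).sub_const c).const_smul t).const_add c
    have hB1 : HasFDerivAt (fun x : E => B' (c + t • (x - c))) _ y :=
      ((hB'.differentiable (by simp) _).hasFDerivAt).comp y hA
    have hC : HasFDerivAt (fun x : E => t • B' (c + t • (x - c)) (x - c)) _ y :=
      (hB1.clm_apply ((hasFDerivAt_id y).sub_const c)).const_smul t
    have hC' : HasFDerivAt (fun x : E => t • B' (c + t • (x - c)) (x - c)) _ y :=
      HasFDerivAt.comp (g := F) (f := fun x => (x, t)) y
        (hF.differentiable one_ne_zero (y, t)).hasFDerivAt (hasFDerivAt_prodMk_left y t)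
    rw [hC'.unique hC]
    simp
    ring
  rw [intervalIntegral.integral_congr (g := fun t => 2 * t * B' (c + t • (y - c)) u v +
      t ^ 2 * fderiv ℝ B' (c + t • (y - c)) (y - c) u v),
    intervalIntegral.integral_eq_sub_of_hasDerivAt (fun t _ => hder t)]
  · simp [hBeq hy]
  · refine Continuous.intervalIntegrable ?_ _ _
    have hl : Continuous fun t : ℝ => c + t • (y - c) := by fun_prop
    have h1 := (((hB'.continuous_fderiv (by simp)).comp hl).clm_apply
      (continuous_const (y := y - c))).clm_apply (continuous_const (y := u))
    have h2 := (hB'.continuous.comp hl).clm_apply (continuous_const (y := u))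
    exact ((continuous_const.mul continuous_id).mul (h2.clm_apply continuous_const)).add
      ((continuous_pow 2).mul (h1.clm_apply continuous_const))
  · intro t ht
    rw [Set.uIcc_of_le zero_le_one] at ht
    simp only [hDt]
    have e1 := hd' _ (hmem t ht) u (y - c) v
    have e2 : B' (c + t • (y - c)) v u = -B' (c + t • (y - c)) u v := by
      rw [hBeq (hmem t ht)]
      exact halt _ (hsub (hmem t ht)) v u
    rw [e2, ← e1]
    ring

end Poincare

/-! ### Exact compactly supported forms are orthogonal to the symplectic form. -/

section FlatIntegral

attribute [-instance] Bundle.instNormedAddCommGroupOfRiemannianBundleOfIsTopologicalAddGroupOfContinuousConstSMulReal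

open MeasureTheory

variable {E : Type*} [NormedAddCommGroup E] [NormedSpace ℝ E]
  {ι : Type*} [Fintype ι] [DecidableEq ι]

/-- The integral of the pairing of an exact compactly supported 2-form `dβ` with a symplectic form
of matrix `w` vanishes. -/
theorem setIntegral_trace_curl_mul_inv_eq_zero [FiniteDimensional ℝ E]
    [MeasurableSpace E] [BorelSpace E] {μ : Measure E} [μ.IsAddHaarMeasure]
    (e : ι → E) {U K : Set E} (hU : IsOpen U)
    (hK : IsCompact K) (hKU : K ⊆ U) {w : E → Matrix ι ι ℝ}
    (hw : ∀ i j, ContDiffOn ℝ 1 (fun y => w y i j) U) (h0 : ∀ y ∈ U, (w y).det ≠ 0)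
    (halt : ∀ y ∈ U, ∀ i j, w y i j = -w y j i)
    (hc : ∀ y ∈ U, ∀ i j k, fderiv ℝ (fun y => w y j k) y (e i) +
      fderiv ℝ (fun y => w y k i) y (e j) + fderiv ℝ (fun y => w y i j) y (e k) = 0)
    {β : E → E →L[ℝ] ℝ} (hβ : ContDiffOn ℝ 1 β U) (hβ0 : ∀ y ∈ U, y ∉ K → β y = 0) :
    ∫ y in U, (1 / 2) * ((Matrix.of fun i j => fderiv ℝ β y (e i) (e j) -
      fderiv ℝ β y (e j) (e i)) * (w y)⁻¹).trace * Real.sqrt |(w y).det| ∂μ = 0 := by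
  set s : E → ℝ := fun y => Real.sqrt |(w y).det|
  have hs : ContDiffOn ℝ 1 s U := contDiffOn_sqrt_abs_det hw h0
  have hA : ∀ i j, ContDiffOn ℝ 1 (fun y => (w y)⁻¹ i j) U := contDiffOn_inv hw h0
  have hβj : ∀ j, ContDiffOn ℝ 1 (fun y => β y (e j)) U := fun j => hβ.clm_apply contDiffOn_const
  -- The field Xⁱ = Σⱼ βⱼ (w⁻¹)ʲⁱ √|det w|, compactly supported, whose divergence is the integrand.
  set X : ι → E → ℝ := fun i y => ∑ j, β y (e j) * ((w y)⁻¹ j i * s y)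
  have hX : ∀ i, ContDiffOn ℝ 1 (X i) U := fun i =>
    ContDiffOn.sum fun j _ => (hβj j).mul ((hA j i).mul hs)
  have hX0 : ∀ i, ∀ y ∈ U, y ∉ K → X i y = 0 := fun i y hy hyK => by
    simp [X, hβ0 y hy hyK]
  have hdiv : Set.EqOn (fun y => (1 / 2) * ((Matrix.of fun i j => fderiv ℝ β y (e i) (e j) -
      fderiv ℝ β y (e j) (e i)) * (w y)⁻¹).trace * s y)
      (fun y => ∑ i, fderiv ℝ (X i) y (e i)) U := by
    intro y hy
    have hU' := hU.mem_nhds hy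
    have dA : ∀ i j, DifferentiableAt ℝ (fun y => (w y)⁻¹ i j) y := fun i j =>
      ((hA i j).contDiffAt hU').differentiableAt one_ne_zero
    have dw : ∀ i j, DifferentiableAt ℝ (fun y => w y i j) y := fun i j =>
      ((hw i j).contDiffAt hU').differentiableAt one_ne_zero
    have ds : DifferentiableAt ℝ s y := (hs.contDiffAt hU').differentiableAt one_ne_zero
    have dβ : DifferentiableAt ℝ β y := (hβ.contDiffAt hU').differentiableAt one_ne_zero
    have dβj : ∀ j, DifferentiableAt ℝ (fun y => β y (e j)) y := fun j =>
      dβ.clm_apply (differentiableAt_const _)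
    have eβ : ∀ j v, fderiv ℝ (fun y => β y (e j)) y v = fderiv ℝ β y v (e j) := fun j v => by
      rw [fderiv_clm_apply dβ (differentiableAt_const _)]
      simp
    have hAalt : ∀ i j, (w y)⁻¹ i j = -(w y)⁻¹ j i := by
      have hT : (w y).transpose = -w y := by
        ext i j
        exact halt y hy j i
      have h2 : ((w y)⁻¹).transpose = -(w y)⁻¹ := by
        rw [Matrix.transpose_nonsing_inv, hT]
        refine Matrix.inv_eq_left_inv ?_
        rw [neg_mul_neg, Matrix.nonsing_inv_mul _ (isUnit_iff_ne_zero.2 (h0 y hy))]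
      intro i j
      exact congrFun (congrFun h2 j) i
    have hXd : ∀ i v, fderiv ℝ (X i) y v = ∑ j, (fderiv ℝ β y v (e j) * ((w y)⁻¹ j i * s y) +
        β y (e j) * (fderiv ℝ (fun y => (w y)⁻¹ j i) y v * s y +
          (w y)⁻¹ j i * fderiv ℝ s y v)) := by
      intro i v
      have h1 : HasFDerivAt (X i) _ y := HasFDerivAt.fun_sum (u := Finset.univ) fun j _ =>
        (dβj j).hasFDerivAt.mul ((dA j i).hasFDerivAt.mul ds.hasFDerivAt)
      rw [h1.fderiv, _root_.sum_apply]
      refine Finset.sum_congr rfl fun j _ => ?_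
      simp only [_root_.add_apply, _root_.smul_apply, smul_eq_mul, eβ]
      ring
    -- Coclosedness: √|det w| w⁻¹ is divergence free, so only the derivatives of β survive in div X.
    have hzero : ∀ j, ∑ i, (fderiv ℝ (fun y => (w y)⁻¹ j i) y (e i) * s y +
          (w y)⁻¹ j i * fderiv ℝ s y (e i)) = 0 := by
      intro j
      have h1 := sum_inverse_derivative_eq_zero (w y)⁻¹ hAalt
        (fun k i j => fderiv ℝ (fun y => w y i j) y (e k)) (fun k i j => by
          have h3 : (fun y => w y i j) =ᶠ[nhds y] fun y => -w y j i := by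
            filter_upwards [hU'] with z hz using halt z hz i j
          simp only [h3.fderiv_eq]
          rw [fderiv_fun_neg]
          rfl) (hc y hy) j
      rw [← mul_zero (s y), ← h1, Finset.mul_sum]
      refine Finset.sum_congr rfl fun i _ => ?_
      rw [fderiv_inv_apply hU hw h0 hy, fderiv_sqrt_abs_det_apply dw (h0 y hy)]
      ring
    simp only [hXd, Finset.sum_add_distrib]
    have e1 : ∑ i, ∑ j, β y (e j) * (fderiv ℝ (fun y => (w y)⁻¹ j i) y (e i) * s y +
          (w y)⁻¹ j i * fderiv ℝ s y (e i)) = 0 := by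
      rw [Finset.sum_comm]
      refine Finset.sum_eq_zero fun j _ => ?_
      rw [← Finset.mul_sum, hzero, mul_zero]
    rw [e1, add_zero]
    simp only [Matrix.trace, Matrix.diag, Matrix.mul_apply, Matrix.of_apply, sub_mul,
      Finset.sum_sub_distrib]
    have e2 : ∑ i, ∑ j, fderiv ℝ β y (e j) (e i) * (w y)⁻¹ j i =
        -∑ i, ∑ j, fderiv ℝ β y (e i) (e j) * (w y)⁻¹ j i := by
      rw [Finset.sum_comm]
      simp only [← Finset.sum_neg_distrib]
      refine Finset.sum_congr rfl fun i _ => Finset.sum_congr rfl fun j _ => ?_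
      rw [hAalt i j]
      ring
    rw [e2]
    simp only [← mul_assoc, ← Finset.sum_mul]
    ring
  rw [setIntegral_congr_fun hU.measurableSet hdiv]
  have hi := fun i => setIntegral_fderiv_eq_zero (μ := μ) hU hK hKU (hX i) (hX0 i) (e i)
  rw [integral_finsetSum _ fun i _ => (hi i).1]
  exact Finset.sum_eq_zero fun i _ => (hi i).2

end FlatIntegral

/-! ### Pullback, smoothness and closedness of forms on vector spaces. -/

section FlatForms

attribute [-instance] Bundle.instNormedAddCommGroupOfRiemannianBundleOfIsTopologicalAddGroupOfContinuousConstSMulReal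

variable {E F : Type*} [NormedAddCommGroup E] [NormedSpace ℝ E] [NormedAddCommGroup F]
  [NormedSpace ℝ F]

/-- The curl of a pulled back 1-form is the pullback of the curl. -/
theorem curl_pullback {lam : F → F →L[ℝ] ℝ} {f : E → F} {y : E}
    (hlam : DifferentiableAt ℝ lam (f y)) (hf : ContDiffAt ℝ ∞ f y) (u v : E) :
    fderiv ℝ (fun y => (lam (f y)).comp (fderiv ℝ f y)) y u v -
        fderiv ℝ (fun y => (lam (f y)).comp (fderiv ℝ f y)) y v u =
      fderiv ℝ lam (f y) (fderiv ℝ f y u) (fderiv ℝ f y v) -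
        fderiv ℝ lam (f y) (fderiv ℝ f y v) (fderiv ℝ f y u) := by
  have hdf : HasFDerivAt f (fderiv ℝ f y) y := (hf.differentiableAt (by simp)).hasFDerivAt
  have hd2 : HasFDerivAt (fderiv ℝ f) (fderiv ℝ (fderiv ℝ f) y) y :=
    ((hf.fderiv_right (m := 1) (by norm_cast)).differentiableAt one_ne_zero).hasFDerivAt
  have hl : HasFDerivAt (fun y => lam (f y)) ((fderiv ℝ lam (f y)).comp (fderiv ℝ f y)) y :=
    HasFDerivAt.comp y hlam.hasFDerivAt hdf
  -- The terms with second derivatives of `f` are symmetric in `u`, `v` and cancel in the curl.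
  have hsymm : IsSymmSndFDerivAt ℝ f y := hf.isSymmSndFDerivAt (by simp; norm_cast)
  have h := (hl.clm_comp hd2).fderiv
  have hs := hsymm.eq u v
  rw [h]
  simp [hs]

/-- A 2-form as a continuous bilinear map. -/
def twoFormCLM [FiniteDimensional ℝ E] (α : E [⋀^Fin 2]→L[ℝ] ℝ) : E →L[ℝ] E →L[ℝ] ℝ :=
  LinearMap.toContinuousBilinearMap (twoFormBilin α)

@[simp]
theorem twoFormCLM_apply [FiniteDimensional ℝ E] (α : E [⋀^Fin 2]→L[ℝ] ℝ) (u v : E) :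
    twoFormCLM α u v = α ![u, v] := rfl

theorem contDiffOn_alternating_apply_const {τ : E → E [⋀^Fin 2]→L[ℝ] ℝ} {U : Set E}
    {n : WithTop ℕ∞} (hτ : ContDiffOn ℝ n τ U) (v : Fin 2 → E) :
    ContDiffOn ℝ n (fun y => τ y v) U := by
  have h : ContDiff ℝ n (ContinuousAlternatingMap.apply ℝ E ℝ v) := by
    apply ContinuousLinearMap.contDiff
  exact h.comp_contDiffOn hτ

theorem contDiffOn_twoFormCLM [FiniteDimensional ℝ E] {τ : E → E [⋀^Fin 2]→L[ℝ] ℝ} {U : Set E}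
    {n : WithTop ℕ∞} (hτ : ContDiffOn ℝ n τ U) : ContDiffOn ℝ n (fun y => twoFormCLM (τ y)) U := by
  refine contDiffOn_clm_apply.2 fun u => contDiffOn_clm_apply.2 fun v => ?_
  exact contDiffOn_alternating_apply_const hτ ![u, v]

theorem cyclic_fderiv_of_extDeriv_eq_zero {τ : E → E [⋀^Fin 2]→L[ℝ] ℝ} {y : E}
    (hτ : DifferentiableAt ℝ τ y) (hd : extDeriv τ y = 0) (u v w : E) :
    fderiv ℝ (fun y => τ y ![v, w]) y u + fderiv ℝ (fun y => τ y ![w, u]) y v +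
      fderiv ℝ (fun y => τ y ![u, v]) y w = 0 := by
  have h := extDeriv_apply hτ ![u, v, w]
  rw [hd] at h
  replace h := h.trans (Fin.sum_univ_three _)
  have e0 : (0 : Fin 3).removeNth ![u, v, w] = ![v, w] := by ext i; fin_cases i <;> rfl
  have e1 : (1 : Fin 3).removeNth ![u, v, w] = ![u, w] := by ext i; fin_cases i <;> rfl
  have e2 : (2 : Fin 3).removeNth ![u, v, w] = ![u, v] := by ext i; fin_cases i <;> rfl
  rw [e0, e1, e2] at h
  have e3 : (fun y => τ y ![w, u]) = fun y => -τ y ![u, w] := funext fun y => twoForm_swap _ _ _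
  rw [e3, fderiv_fun_neg]
  simp at h ⊢
  linarith

theorem cyclic_fderiv_twoFormCLM [FiniteDimensional ℝ E] {τ : E → E [⋀^Fin 2]→L[ℝ] ℝ} {U : Set E}
    (hU : IsOpen U) (hτ : ContDiffOn ℝ ∞ τ U) (hd : ∀ y ∈ U, extDeriv τ y = 0) {y : E} (hy : y ∈ U)
    (u v w : E) :
    fderiv ℝ (fun y => twoFormCLM (τ y)) y u v w + fderiv ℝ (fun y => twoFormCLM (τ y)) y v w u +
      fderiv ℝ (fun y => twoFormCLM (τ y)) y w u v = 0 := by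
  have hB := ((contDiffOn_twoFormCLM hτ).contDiffAt (hU.mem_nhds hy)).differentiableAt
    (by simp) |>.hasFDerivAt
  have h1 : ∀ a b c, fderiv ℝ (fun y => twoFormCLM (τ y)) y a b c =
      fderiv ℝ (fun y => τ y ![b, c]) y a := fun a b c => by
    have h2 : HasFDerivAt (fun y => τ y ![b, c]) _ y :=
      (hB.clm_apply (hasFDerivAt_const b y)).clm_apply (hasFDerivAt_const c y)
    rw [h2.fderiv]
    simp
  rw [h1, h1, h1]
  exact cyclic_fderiv_of_extDeriv_eq_zero
    ((hτ.contDiffAt (hU.mem_nhds hy)).differentiableAt (by simp)) (hd y hy) u v w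

end FlatForms

/-! ### Coordinate expressions of maps and forms. -/

section Coordinates

open Topology Set

variable {m : ℕ} {M : Type*} [TopologicalSpace M]
  [ChartedSpace (EuclideanSpace ℝ (Fin m)) M]

/-- The coordinate expression of a map in the preferred charts at `x₀` and `y₀`. -/
def coordRep (f : M → M) (x₀ y₀ : M) : EuclideanSpace ℝ (Fin m) → EuclideanSpace ℝ (Fin m) :=
  fun y => extChartAt (𝓡 m) y₀ (f ((extChartAt (𝓡 m) x₀).symm y))

/-- The standard basis of the coordinate space. -/
def stdVec (m : ℕ) (i : Fin m) : EuclideanSpace ℝ (Fin m) := EuclideanSpace.single i 1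

theorem isOpen_chart_target (x₀ : M) : IsOpen (extChartAt (𝓡 m) x₀).target :=
  isOpen_extChartAt_target x₀

theorem isOpen_chart_source (x₀ : M) : IsOpen (extChartAt (𝓡 m) x₀).source :=
  isOpen_extChartAt_source x₀

/-- All tangent spaces are definitionally the model space, so values at provably equal points can be
compared without transport. -/
theorem form_apply_congr {k : ℕ} (α : FormField m k M) {p q : M} (h : p = q)
    (v : Fin k → EuclideanSpace ℝ (Fin m)) :
    (α p : (EuclideanSpace ℝ (Fin m)) [⋀^Fin k]→L[ℝ] ℝ) v =
      (α q : (EuclideanSpace ℝ (Fin m)) [⋀^Fin k]→L[ℝ] ℝ) v := by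
  subst h; rfl

variable [IsManifold (𝓡 m) ∞ M]

theorem contMDiffAt_chart_symm {x₀ : M} {y : EuclideanSpace ℝ (Fin m)}
    (hy : y ∈ (extChartAt (𝓡 m) x₀).target) :
    ContMDiffAt (𝓡 m) (𝓡 m) ∞ (extChartAt (𝓡 m) x₀).symm y :=
  (contMDiffOn_extChartAt_symm x₀).contMDiffAt ((isOpen_chart_target x₀).mem_nhds hy)

theorem contMDiffAt_chart {x₀ x : M} (hx : x ∈ (extChartAt (𝓡 m) x₀).source) :
    ContMDiffAt (𝓡 m) (𝓡 m) ∞ (extChartAt (𝓡 m) x₀) x :=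
  contMDiffAt_extChartAt' (by simpa using hx)

theorem contDiffAt_coordRep {f : M → M} {x₀ y₀ : M} {y : EuclideanSpace ℝ (Fin m)}
    (hy : y ∈ (extChartAt (𝓡 m) x₀).target)
    (hf : ContMDiffAt (𝓡 m) (𝓡 m) ∞ f ((extChartAt (𝓡 m) x₀).symm y))
    (hfy : f ((extChartAt (𝓡 m) x₀).symm y) ∈ (extChartAt (𝓡 m) y₀).source) :
    ContDiffAt ℝ ∞ (coordRep f x₀ y₀) y := by
  rw [← contMDiffAt_iff_contDiffAt]
  exact (contMDiffAt_chart hfy).comp y (hf.comp y (contMDiffAt_chart_symm hy))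

/-- Near `y`, f ∘ (chart at x₀)⁻¹ equals (chart at y₀)⁻¹ ∘ `coordRep f x₀ y₀`; both sides are the
derivative of this map. -/
theorem mfderiv_comp_chart_symm {f : M → M} {x₀ y₀ : M} {y : EuclideanSpace ℝ (Fin m)}
    (hy : y ∈ (extChartAt (𝓡 m) x₀).target)
    (hf : ContMDiffAt (𝓡 m) (𝓡 m) ∞ f ((extChartAt (𝓡 m) x₀).symm y))
    (hfy : f ((extChartAt (𝓡 m) x₀).symm y) ∈ (extChartAt (𝓡 m) y₀).source)
    (v : EuclideanSpace ℝ (Fin m)) :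
    (mfderiv (𝓡 m) (𝓡 m) f ((extChartAt (𝓡 m) x₀).symm y)
      (mfderiv (𝓡 m) (𝓡 m) (extChartAt (𝓡 m) x₀).symm y v) : EuclideanSpace ℝ (Fin m)) =
    mfderiv (𝓡 m) (𝓡 m) (extChartAt (𝓡 m) y₀).symm (coordRep f x₀ y₀ y)
      (fderiv ℝ (coordRep f x₀ y₀) y v) := by
  have h1 : HasMFDerivAt (𝓡 m) (𝓡 m) (f ∘ (extChartAt (𝓡 m) x₀).symm) y _ :=
    (hf.mdifferentiableAt (by simp)).hasMFDerivAt.comp y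
      ((contMDiffAt_chart_symm hy).mdifferentiableAt (by simp)).hasMFDerivAt
  have hr := contDiffAt_coordRep hy hf hfy
  have hr' : HasMFDerivAt (𝓡 m) (𝓡 m) (coordRep f x₀ y₀) y (fderiv ℝ (coordRep f x₀ y₀) y) :=
    (hr.differentiableAt (by simp)).hasFDerivAt.hasMFDerivAt
  have hmem : coordRep f x₀ y₀ y ∈ (extChartAt (𝓡 m) y₀).target :=
    (extChartAt (𝓡 m) y₀).map_source hfy
  have h2 : HasMFDerivAt (𝓡 m) (𝓡 m) ((extChartAt (𝓡 m) y₀).symm ∘ coordRep f x₀ y₀) y _ :=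
    ((contMDiffAt_chart_symm hmem).mdifferentiableAt (by simp)).hasMFDerivAt.comp y hr'
  have heq : (f ∘ (extChartAt (𝓡 m) x₀).symm) =ᶠ[𝓝 y]
      ((extChartAt (𝓡 m) y₀).symm ∘ coordRep f x₀ y₀) := by
    have hc : ContinuousAt (f ∘ (extChartAt (𝓡 m) x₀).symm) y := h1.continuousAt
    filter_upwards [hc.preimage_mem_nhds ((isOpen_chart_source y₀).mem_nhds hfy)] with z hz
    exact ((extChartAt (𝓡 m) y₀).left_inv hz).symm
  have h3 := h2.congr_of_eventuallyEq heq
  have h4 := hasMFDerivAt_unique h1 h3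
  exact congrArg (fun L : EuclideanSpace ℝ (Fin m) →L[ℝ] EuclideanSpace ℝ (Fin m) => L v) h4

/-- The coordinate expression of a pulled back form is the pullback of the coordinate expression. -/
theorem chartForm_formPullback_apply {k : ℕ} (α : FormField m k M) {f : M → M} {x₀ y₀ : M}
    {y : EuclideanSpace ℝ (Fin m)} (hy : y ∈ (extChartAt (𝓡 m) x₀).target)
    (hf : ContMDiffAt (𝓡 m) (𝓡 m) ∞ f ((extChartAt (𝓡 m) x₀).symm y))
    (hfy : f ((extChartAt (𝓡 m) x₀).symm y) ∈ (extChartAt (𝓡 m) y₀).source)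
    (v : Fin k → EuclideanSpace ℝ (Fin m)) :
    chartForm (formPullback (m := m) f α) x₀ y v =
      chartForm α y₀ (coordRep f x₀ y₀ y) (fun i => fderiv ℝ (coordRep f x₀ y₀) y (v i)) := by
  have h1 : (extChartAt (𝓡 m) y₀).symm (coordRep f x₀ y₀ y) = f ((extChartAt (𝓡 m) x₀).symm y) :=
    (extChartAt (𝓡 m) y₀).left_inv hfy
  refine Eq.trans ?_ (form_apply_congr α h1 _).symm
  exact congrArg (α (f ((extChartAt (𝓡 m) x₀).symm y)))
    (funext fun i => mfderiv_comp_chart_symm hy hf hfy (v i))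

theorem bijective_mfderiv_chart_symm (x₀ : M) {y : EuclideanSpace ℝ (Fin m)}
    (hy : y ∈ (extChartAt (𝓡 m) x₀).target) :
    Function.Bijective (mfderiv (𝓡 m) (𝓡 m) (extChartAt (𝓡 m) x₀).symm y) := by
  have h := isInvertible_mfderivWithin_extChartAt_symm (I := 𝓡 m) hy
  rw [show range (𝓡 m) = univ from range_id, mfderivWithin_univ] at h
  exact h.bijective

/-- The derivative of an inverse chart, as a linear equivalence. -/
def chartEquiv (x₀ : M) {y : EuclideanSpace ℝ (Fin m)} (hy : y ∈ (extChartAt (𝓡 m) x₀).target) :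
    EuclideanSpace ℝ (Fin m) ≃ₗ[ℝ] TangentSpace (𝓡 m) ((extChartAt (𝓡 m) x₀).symm y) :=
  LinearEquiv.ofBijective
    (mfderiv (𝓡 m) (𝓡 m) (extChartAt (𝓡 m) x₀).symm y).toLinearMap
    (bijective_mfderiv_chart_symm x₀ hy)

/-- The basis of coordinate vectors. -/
def coordBasis (x₀ : M) {y : EuclideanSpace ℝ (Fin m)} (hy : y ∈ (extChartAt (𝓡 m) x₀).target) :
    Module.Basis (Fin m) ℝ (TangentSpace (𝓡 m) ((extChartAt (𝓡 m) x₀).symm y)) :=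
  (EuclideanSpace.basisFun (Fin m) ℝ).toBasis.map (chartEquiv x₀ hy)

theorem coordBasis_apply (x₀ : M) {y : EuclideanSpace ℝ (Fin m)}
    (hy : y ∈ (extChartAt (𝓡 m) x₀).target) (i : Fin m) :
    coordBasis x₀ hy i =
      mfderiv (𝓡 m) (𝓡 m) (extChartAt (𝓡 m) x₀).symm y (stdVec m i) := by
  rw [coordBasis, Module.Basis.map_apply, OrthonormalBasis.coe_toBasis,
    EuclideanSpace.basisFun_apply]
  rfl

theorem twoFormMatrix_chartForm (α : FormField m 2 M) (x₀ : M) {y : EuclideanSpace ℝ (Fin m)}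
    (hy : y ∈ (extChartAt (𝓡 m) x₀).target) :
    twoFormMatrix (chartForm α x₀ y) (stdVec m) =
      twoFormMatrix (α ((extChartAt (𝓡 m) x₀).symm y)) (coordBasis x₀ hy) := by
  ext i j
  simp only [twoFormMatrix, Matrix.of_apply, coordBasis_apply]
  refine congrArg (α ((extChartAt (𝓡 m) x₀).symm y)) (funext fun k => ?_)
  fin_cases k <;> rfl

end Coordinates

/-! ### The metric and the inner product of 2-forms in coordinates. -/

section Metric

open Topology Set

theorem gramMatrix_sum_smul {V ι κ : Type*} [NormedAddCommGroup V] [InnerProductSpace ℝ V]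
    [Fintype ι] (b : ι → V) (D : Matrix ι κ ℝ) :
    gramMatrix (fun k => ∑ a, D a k • b a) = D.transpose * gramMatrix b * D := by
  ext k l
  simp only [gramMatrix, Matrix.of_apply, Matrix.mul_apply, Matrix.transpose_apply, sum_inner,
    inner_sum, real_inner_smul_left, real_inner_smul_right, Finset.sum_mul]
  refine Finset.sum_congr rfl fun a _ => Finset.sum_congr rfl fun c _ => ?_
  ring

variable {m : ℕ} {M : Type*} [TopologicalSpace M]
  [ChartedSpace (EuclideanSpace ℝ (Fin m)) M]
  [RiemannianBundle (fun x : M => TangentSpace (𝓡 m) x)]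

/-- The inner product of two 2-forms at a point. -/
def formInner {x : M} (α β : (TangentSpace (𝓡 m) x) [⋀^Fin 2]→L[ℝ] ℝ) : ℝ :=
  letI : FiniteDimensional ℝ (TangentSpace (𝓡 m) x) :=
    inferInstanceAs (FiniteDimensional ℝ (EuclideanSpace ℝ (Fin m)))
  letI e := stdOrthonormalBasis ℝ (TangentSpace (𝓡 m) x)
  (1 / 2) * ∑ i, ∑ j, α ![e i, e j] * β ![e i, e j]

theorem formInner_self {x : M} (α : (TangentSpace (𝓡 m) x) [⋀^Fin 2]→L[ℝ] ℝ) :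
    formInner α α = normSqTwoForm α := by
  simp only [formInner, normSqTwoForm, pow_two]

/-- This is |α - β|² ≥ 0 expanded. -/
theorem two_mul_formInner_sub_le {x : M} (α β : (TangentSpace (𝓡 m) x) [⋀^Fin 2]→L[ℝ] ℝ) :
    2 * formInner α β - normSqTwoForm β ≤ normSqTwoForm α := by
  simp only [formInner, normSqTwoForm]
  rw [← sub_nonneg]
  have h : ∀ (n : ℕ) (A B : Fin n → Fin n → ℝ), (1 / 2) * ∑ i, ∑ j, A i j ^ 2 -
      (2 * ((1 / 2) * ∑ i, ∑ j, A i j * B i j) - (1 / 2) * ∑ i, ∑ j, B i j ^ 2) =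
      (1 / 2) * ∑ i, ∑ j, (A i j - B i j) ^ 2 := by
    intro n A B
    simp only [Finset.mul_sum, ← Finset.sum_sub_distrib]
    refine Finset.sum_congr rfl fun i _ => Finset.sum_congr rfl fun j _ => ?_
    ring
  rw [h]
  positivity

theorem inner_congr_point {p q : M} (h : p = q) (u v : EuclideanSpace ℝ (Fin m)) :
    inner ℝ (show TangentSpace (𝓡 m) p from u) (show TangentSpace (𝓡 m) p from v) =
      inner ℝ (show TangentSpace (𝓡 m) q from u) (show TangentSpace (𝓡 m) q from v) := by
  subst h; rfl

variable [IsManifold (𝓡 m) ∞ M]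

theorem metricMatrix_eq_gramMatrix (x₀ : M) {y : EuclideanSpace ℝ (Fin m)}
    (hy : y ∈ (extChartAt (𝓡 m) x₀).target) :
    metricMatrix x₀ y = gramMatrix (coordBasis x₀ hy) := by
  ext i j
  simp only [metricMatrix, gramMatrix, Matrix.of_apply, coordBasis_apply]
  rfl

theorem formInner_eq_trace (α β : FormField m 2 M) (x₀ : M) {y : EuclideanSpace ℝ (Fin m)}
    (hy : y ∈ (extChartAt (𝓡 m) x₀).target) :
    formInner (α ((extChartAt (𝓡 m) x₀).symm y)) (β ((extChartAt (𝓡 m) x₀).symm y)) =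
      (1 / 2) * (twoFormMatrix (chartForm α x₀ y) (stdVec m) * (metricMatrix x₀ y)⁻¹ *
        (twoFormMatrix (chartForm β x₀ y) (stdVec m)).transpose * (metricMatrix x₀ y)⁻¹).trace := by
  let _ : FiniteDimensional ℝ (TangentSpace (𝓡 m) ((extChartAt (𝓡 m) x₀).symm y)) :=
    inferInstanceAs (FiniteDimensional ℝ (EuclideanSpace ℝ (Fin m)))
  rw [twoFormMatrix_chartForm α x₀ hy, twoFormMatrix_chartForm β x₀ hy,
    metricMatrix_eq_gramMatrix x₀ hy]
  exact half_sum_orthonormal_eq_trace (coordBasis x₀ hy) (stdOrthonormalBasis ℝ _) _ _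

theorem isUnit_det_metricMatrix (x₀ : M) {y : EuclideanSpace ℝ (Fin m)}
    (hy : y ∈ (extChartAt (𝓡 m) x₀).target) : IsUnit (metricMatrix x₀ y).det := by
  let _ : FiniteDimensional ℝ (TangentSpace (𝓡 m) ((extChartAt (𝓡 m) x₀).symm y)) :=
    inferInstanceAs (FiniteDimensional ℝ (EuclideanSpace ℝ (Fin m)))
  rw [metricMatrix_eq_gramMatrix x₀ hy]
  exact isUnit_det_gramMatrix _

section Compatible

variable {σ : SymplecticForm m M}

/-- Pairing with σ itself involves no metric: both inverse metric factors are absorbed into the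
inverse matrix of σ. -/
theorem formInner_symplectic_eq_trace (hσ : IsCompatible σ) (α : FormField m 2 M) (x₀ : M)
    {y : EuclideanSpace ℝ (Fin m)} (hy : y ∈ (extChartAt (𝓡 m) x₀).target) :
    formInner (α ((extChartAt (𝓡 m) x₀).symm y)) (σ.form ((extChartAt (𝓡 m) x₀).symm y)) =
      (1 / 2) * (twoFormMatrix (chartForm α x₀ y) (stdVec m) *
        (twoFormMatrix (chartForm σ.form x₀ y) (stdVec m))⁻¹).trace := by
  let _ : FiniteDimensional ℝ (TangentSpace (𝓡 m) ((extChartAt (𝓡 m) x₀).symm y)) :=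
    inferInstanceAs (FiniteDimensional ℝ (EuclideanSpace ℝ (Fin m)))
  obtain ⟨J, hJ, hJσ⟩ := hσ
  rw [formInner_eq_trace α σ.form x₀ hy, twoFormMatrix_chartForm σ.form x₀ hy,
    twoFormMatrix_inv_of_compatible (coordBasis x₀ hy) _ (J _) (hJ _) (hJσ _),
    metricMatrix_eq_gramMatrix x₀ hy]
  simp only [Matrix.mul_assoc]

theorem det_metricMatrix (hσ : IsCompatible σ) (x₀ : M) {y : EuclideanSpace ℝ (Fin m)}
    (hy : y ∈ (extChartAt (𝓡 m) x₀).target) :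
    (metricMatrix x₀ y).det = |(twoFormMatrix (chartForm σ.form x₀ y) (stdVec m)).det| := by
  let _ : FiniteDimensional ℝ (TangentSpace (𝓡 m) ((extChartAt (𝓡 m) x₀).symm y)) :=
    inferInstanceAs (FiniteDimensional ℝ (EuclideanSpace ℝ (Fin m)))
  obtain ⟨J, hJ, hJσ⟩ := hσ
  rw [twoFormMatrix_chartForm σ.form x₀ hy, metricMatrix_eq_gramMatrix x₀ hy]
  exact det_gramMatrix_of_compatible (coordBasis x₀ hy) _ (J _) (hJ _) (hJσ _)

theorem det_chartForm_ne_zero (hσ : IsCompatible σ) (x₀ : M) {y : EuclideanSpace ℝ (Fin m)}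
    (hy : y ∈ (extChartAt (𝓡 m) x₀).target) :
    (twoFormMatrix (chartForm σ.form x₀ y) (stdVec m)).det ≠ 0 := by
  rw [← abs_ne_zero, ← det_metricMatrix hσ x₀ hy]
  exact (isUnit_det_metricMatrix x₀ hy).ne_zero

end Compatible

/-- The transition map between preferred charts. -/
def transition (x₀ x₁ : M) : EuclideanSpace ℝ (Fin m) → EuclideanSpace ℝ (Fin m) :=
  coordRep id x₀ x₁

/-- The coordinate vectors of one chart are combinations of those of the other, with coefficients
the Jacobian D of the transition map; hence √det g is multiplied by |det D|. -/
theorem metricMatrix_transition {x₀ x₁ : M} {y : EuclideanSpace ℝ (Fin m)}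
    (hy : y ∈ (extChartAt (𝓡 m) x₀).target)
    (hy1 : (extChartAt (𝓡 m) x₀).symm y ∈ (extChartAt (𝓡 m) x₁).source) :
    metricMatrix x₀ y =
      (LinearMap.toMatrix (EuclideanSpace.basisFun (Fin m) ℝ).toBasis
        (EuclideanSpace.basisFun (Fin m) ℝ).toBasis
        (fderiv ℝ (transition x₀ x₁) y).toLinearMap).transpose *
      metricMatrix x₁ (transition x₀ x₁ y) *
      (LinearMap.toMatrix (EuclideanSpace.basisFun (Fin m) ℝ).toBasis
        (EuclideanSpace.basisFun (Fin m) ℝ).toBasis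
        (fderiv ℝ (transition x₀ x₁) y).toLinearMap) := by
  set D := LinearMap.toMatrix (EuclideanSpace.basisFun (Fin m) ℝ).toBasis
        (EuclideanSpace.basisFun (Fin m) ℝ).toBasis
        (fderiv ℝ (transition x₀ x₁) y).toLinearMap
  have hmem : transition x₀ x₁ y ∈ (extChartAt (𝓡 m) x₁).target :=
    (extChartAt (𝓡 m) x₁).map_source hy1
  have hp : (extChartAt (𝓡 m) x₁).symm (transition x₀ x₁ y) = (extChartAt (𝓡 m) x₀).symm y :=
    (extChartAt (𝓡 m) x₁).left_inv hy1
  have hvec : ∀ i, (mfderiv (𝓡 m) (𝓡 m) (extChartAt (𝓡 m) x₀).symm y (stdVec m i) :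
      EuclideanSpace ℝ (Fin m)) = mfderiv (𝓡 m) (𝓡 m) (extChartAt (𝓡 m) x₁).symm
        (transition x₀ x₁ y) (fderiv ℝ (transition x₀ x₁) y (stdVec m i)) := fun i => by
    have := mfderiv_comp_chart_symm (f := id) hy contMDiffAt_id hy1 (stdVec m i)
    rw [mfderiv_id] at this
    exact this
  have hsum : ∀ i, fderiv ℝ (transition x₀ x₁) y (stdVec m i) = ∑ a, D a i • stdVec m a := by
    intro i
    have := (EuclideanSpace.basisFun (Fin m) ℝ).toBasis.sum_repr
      (fderiv ℝ (transition x₀ x₁) y (stdVec m i))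
    rw [← this]
    refine Finset.sum_congr rfl fun a _ => ?_
    simp [D, LinearMap.toMatrix_apply, stdVec]
  rw [metricMatrix_eq_gramMatrix x₁ hmem, ← gramMatrix_sum_smul]
  ext i j
  have hb : ∀ i, (∑ a, D a i • coordBasis x₁ hmem a) =
      mfderiv (𝓡 m) (𝓡 m) (extChartAt (𝓡 m) x₁).symm (transition x₀ x₁ y)
        (fderiv ℝ (transition x₀ x₁) y (stdVec m i)) := by
    intro i
    rw [hsum]
    refine Eq.trans ?_ (map_sum (chartEquiv x₁ hmem) (fun a => D a i • stdVec m a) _).symm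
    refine Finset.sum_congr rfl fun a _ => ?_
    rw [coordBasis_apply]
    exact (map_smul (chartEquiv x₁ hmem) _ _).symm
  simp only [gramMatrix, Matrix.of_apply, hb]
  refine Eq.trans ?_ (inner_congr_point hp _ _).symm
  rw [← hvec, ← hvec]
  rfl

end Metric

/-! ### Continuity of the metric coefficients and of inner products of forms. -/

section Regularity

open Topology Set

variable {m : ℕ} {M : Type*} [TopologicalSpace M]
  [ChartedSpace (EuclideanSpace ℝ (Fin m)) M]

/-- The coordinate expressions of the 2-form are continuous. -/
def HasContinuousCoords (α : FormField m 2 M) : Prop :=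
  ∀ (x₀ : M) (i j : Fin m), ContinuousOn
    (fun y => twoFormMatrix (chartForm α x₀ y) (stdVec m) i j) (extChartAt (𝓡 m) x₀).target

theorem IsSmoothForm.contDiffOn_apply {α : FormField m 2 M} (hα : IsSmoothForm α) (x₀ : M)
    (v : Fin 2 → EuclideanSpace ℝ (Fin m)) :
    ContDiffOn ℝ ∞ (fun y => chartForm α x₀ y v) (extChartAt (𝓡 m) x₀).target :=
  contDiffOn_alternating_apply_const (hα x₀) v

theorem IsSmoothForm.hasContinuousCoords {α : FormField m 2 M} (hα : IsSmoothForm α) :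
    HasContinuousCoords α := fun x₀ i j =>
  (hα.contDiffOn_apply x₀ ![stdVec m i, stdVec m j]).continuousOn

variable [IsManifold (𝓡 m) ∞ M]

theorem twoFormMatrix_chartForm_formPullback (α : FormField m 2 M) {f : M → M} {x₀ y₀ : M}
    {y : EuclideanSpace ℝ (Fin m)} (hy : y ∈ (extChartAt (𝓡 m) x₀).target)
    (hf : ContMDiffAt (𝓡 m) (𝓡 m) ∞ f ((extChartAt (𝓡 m) x₀).symm y))
    (hfy : f ((extChartAt (𝓡 m) x₀).symm y) ∈ (extChartAt (𝓡 m) y₀).source) (i j : Fin m) :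
    twoFormMatrix (chartForm (formPullback (m := m) f α) x₀ y) (stdVec m) i j =
      twoFormCLM (chartForm α y₀ (coordRep f x₀ y₀ y))
        (fderiv ℝ (coordRep f x₀ y₀) y (stdVec m i))
        (fderiv ℝ (coordRep f x₀ y₀) y (stdVec m j)) := by
  simp only [twoFormMatrix, Matrix.of_apply, twoFormCLM_apply]
  rw [chartForm_formPullback_apply α hy hf hfy]
  congr 1
  ext k : 1
  fin_cases k <;> rfl

theorem IsSmoothForm.hasContinuousCoords_formPullback {α : FormField m 2 M} (hα : IsSmoothForm α)
    {f : M → M} (hf : ContMDiff (𝓡 m) (𝓡 m) ∞ f) :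
    HasContinuousCoords (formPullback (m := m) f α) := by
  intro x₀ i j y hy
  refine ContinuousAt.continuousWithinAt ?_
  set y₀ := f ((extChartAt (𝓡 m) x₀).symm y)
  have hfy : f ((extChartAt (𝓡 m) x₀).symm y) ∈ (extChartAt (𝓡 m) y₀).source :=
    mem_extChartAt_source y₀
  have hc : ContinuousAt (fun z => f ((extChartAt (𝓡 m) x₀).symm z)) y :=
    hf.continuous.continuousAt.comp (contMDiffAt_chart_symm hy).continuousAt
  have heq : (fun z => twoFormMatrix (chartForm (formPullback (m := m) f α) x₀ z) (stdVec m) i j)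
      =ᶠ[𝓝 y] fun z => twoFormCLM (chartForm α y₀ (coordRep f x₀ y₀ z))
        (fderiv ℝ (coordRep f x₀ y₀) z (stdVec m i))
        (fderiv ℝ (coordRep f x₀ y₀) z (stdVec m j)) := by
    filter_upwards [(isOpen_chart_target x₀).mem_nhds hy,
      hc.preimage_mem_nhds ((isOpen_chart_source y₀).mem_nhds hfy)] with z hz hz'
    exact twoFormMatrix_chartForm_formPullback α hz hf.contMDiffAt hz' i j
  refine ContinuousAt.congr ?_ heq.symm
  have hr := contDiffAt_coordRep hy hf.contMDiffAt hfy
  have hB : ContinuousAt (fun z => twoFormCLM (chartForm α y₀ z)) (coordRep f x₀ y₀ y) :=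
    (contDiffOn_twoFormCLM (hα y₀)).continuousOn.continuousAt
      ((isOpen_chart_target y₀).mem_nhds ((extChartAt (𝓡 m) y₀).map_source hfy))
  have hB' : ContinuousAt (fun z => twoFormCLM (chartForm α y₀ (coordRep f x₀ y₀ z))) y :=
    ContinuousAt.comp (g := fun z => twoFormCLM (chartForm α y₀ z)) hB hr.continuousAt
  have hd : ContinuousAt (fderiv ℝ (coordRep f x₀ y₀)) y :=
    (hr.fderiv_right (m := 0) (by simp)).continuousAt
  exact (hB'.clm_apply (hd.clm_apply continuousAt_const)).clm_apply
    (hd.clm_apply continuousAt_const)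

/-- Coordinate fields are images of constant sections under the tangent map of the inverse chart.
Class C⁰ suffices for continuity of g(∂ᵢ, ∂ⱼ). -/
theorem contMDiffOn_coordVector (x₀ : M) (i : Fin m) :
    ContMDiffOn (𝓡 m) ((𝓡 m).prod (𝓡 m)) 0 (fun y => (TotalSpace.mk' (EuclideanSpace ℝ (Fin m))
      ((extChartAt (𝓡 m) x₀).symm y) (coordVector x₀ y i) : TangentBundle (𝓡 m) M))
      (extChartAt (𝓡 m) x₀).target := by
  have hU := isOpen_chart_target (m := m) x₀
  have h1 := (contMDiffOn_extChartAt_symm (I := 𝓡 m) (n := ∞) x₀).contMDiffOn_tangentMapWithin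
    (m := 0) (by simp) hU.uniqueMDiffOn
  have h2 : ContMDiff (𝓡 m) ((𝓡 m).prod (𝓡 m)) 0 (fun y : EuclideanSpace ℝ (Fin m) =>
      (TotalSpace.mk' (EuclideanSpace ℝ (Fin m)) y (stdVec m i) :
        TangentBundle (𝓡 m) (EuclideanSpace ℝ (Fin m)))) :=
    contMDiff_vectorSpace_iff_contDiff.2 contDiff_const
  refine (h1.comp h2.contMDiffOn fun y hy => hy).congr fun y hy => ?_
  simp only [Function.comp, tangentMapWithin, TotalSpace.mk', mfderivWithin_of_isOpen hU hy]
  rfl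

variable [RiemannianBundle (fun x : M => TangentSpace (𝓡 m) x)]
  [IsContMDiffRiemannianBundle (𝓡 m) ∞ (EuclideanSpace ℝ (Fin m))
      (fun x : M => TangentSpace (𝓡 m) x)]

theorem continuousOn_metricMatrix (x₀ : M) (i j : Fin m) :
    ContinuousOn (fun y => metricMatrix x₀ y i j) (extChartAt (𝓡 m) x₀).target :=
  ((contMDiffOn_coordVector x₀ i).inner_bundle (contMDiffOn_coordVector x₀ j)).continuousOn

/-- The orthonormal basis in `formInner` is chosen separately at each point, so continuity is read
off from the trace formula in a chart. -/
theorem continuous_formInner {α β : FormField m 2 M} (hα : HasContinuousCoords α)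
    (hβ : HasContinuousCoords β) : Continuous fun x => formInner (α x) (β x) := by
  refine continuous_iff_continuousAt.2 fun x => ?_
  have hG : ∀ i j, ContinuousOn (fun y => (metricMatrix x y)⁻¹ i j) (extChartAt (𝓡 m) x).target :=
    fun i j => (contDiffOn_inv (n := 0)
      (fun i j => contDiffOn_zero.2 (continuousOn_metricMatrix x i j))
      (fun y hy => (isUnit_det_metricMatrix x hy).ne_zero) i j).continuousOn
  have hF : ContinuousOn (fun y => (1 / 2 : ℝ) * (twoFormMatrix (chartForm α x y) (stdVec m) *
      (metricMatrix x y)⁻¹ * (twoFormMatrix (chartForm β x y) (stdVec m)).transpose *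
      (metricMatrix x y)⁻¹).trace) (extChartAt (𝓡 m) x).target := by
    simp only [Matrix.trace, Matrix.diag, Matrix.mul_apply, Matrix.transpose_apply]
    refine continuousOn_const.mul (continuousOn_finsetSum _ fun a _ =>
      continuousOn_finsetSum _ fun b _ => ContinuousOn.mul (continuousOn_finsetSum _ fun c _ =>
        ContinuousOn.mul (continuousOn_finsetSum _ fun d _ => ContinuousOn.mul ?_ ?_) ?_) ?_)
    · exact hα x _ _
    · exact hG _ _
    · exact hβ x _ _
    · exact hG _ _
  have hx : extChartAt (𝓡 m) x x ∈ (extChartAt (𝓡 m) x).target := mem_extChartAt_target x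
  have h1 := (hF.continuousAt ((isOpen_chart_target x).mem_nhds hx)).comp
    (continuousAt_extChartAt (I := 𝓡 m) x)
  refine h1.congr ?_
  filter_upwards [extChartAt_source_mem_nhds (I := 𝓡 m) x] with z hz
  have h2 := formInner_eq_trace α β x ((extChartAt (𝓡 m) x).map_source hz)
  rw [(extChartAt (𝓡 m) x).left_inv hz] at h2
  exact h2.symm

end Regularity

/-! ### The Riemannian volume in charts, and its finiteness. -/

section Volume

open Topology Set MeasureTheory

variable {m : ℕ} {M : Type*} [TopologicalSpace M]
  [ChartedSpace (EuclideanSpace ℝ (Fin m)) M]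

section Measurability

variable [MeasurableSpace M] [BorelSpace M]

theorem aemeasurable_chart_symm (x₀ : M) (ρ : EuclideanSpace ℝ (Fin m) → ENNReal) :
    AEMeasurable (extChartAt (𝓡 m) x₀).symm
      ((volume.restrict (extChartAt (𝓡 m) x₀).target).withDensity ρ) := by
  classical
  have hU := isOpen_chart_target (m := m) x₀
  refine AEMeasurable.mono_ac ?_ (withDensity_absolutelyContinuous _ _)
  -- The inverse chart is controlled only on its target; a constant off the target gives a
  -- measurable representative.
  refine ⟨fun y => if y ∈ (extChartAt (𝓡 m) x₀).target then (extChartAt (𝓡 m) x₀).symm y else x₀,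
    ?_, ?_⟩
  · exact (continuousOn_extChartAt_symm (I := 𝓡 m) x₀).measurable_piecewise
      continuous_const.continuousOn hU.measurableSet
  · filter_upwards [ae_restrict_mem hU.measurableSet] with y hy
    exact (if_pos hy).symm

theorem measurableSet_chart_preimage (x₀ : M) {A : Set M} (hA : MeasurableSet A) :
    MeasurableSet ((extChartAt (𝓡 m) x₀).symm ⁻¹' A ∩ (extChartAt (𝓡 m) x₀).target) := by
  classical
  have hU := isOpen_chart_target (m := m) x₀
  have h : Measurable fun y => if y ∈ (extChartAt (𝓡 m) x₀).target then
      (extChartAt (𝓡 m) x₀).symm y else x₀ :=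
    (continuousOn_extChartAt_symm (I := 𝓡 m) x₀).measurable_piecewise
      continuous_const.continuousOn hU.measurableSet
  convert (h hA).inter hU.measurableSet using 1
  ext y
  simp only [mem_inter_iff, mem_preimage]
  refine and_congr_left fun hy => ?_
  rw [if_pos hy]

variable [RiemannianBundle (fun x : M => TangentSpace (𝓡 m) x)]

theorem chartVolume_apply (x₀ : M) {A : Set M} (hA : MeasurableSet A) :
    chartVolume (m := m) x₀ A =
      ∫⁻ y in (extChartAt (𝓡 m) x₀).symm ⁻¹' A ∩ (extChartAt (𝓡 m) x₀).target,
        ENNReal.ofReal (Real.sqrt (metricMatrix x₀ y).det) := by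
  rw [chartVolume, Measure.map_apply_of_aemeasurable (aemeasurable_chart_symm x₀ _) hA,
    withDensity_apply', Measure.restrict_restrict' (isOpen_chart_target x₀).measurableSet]

theorem chartVolume_compl_source (x₀ : M) :
    chartVolume (m := m) x₀ (extChartAt (𝓡 m) x₀).sourceᶜ = 0 := by
  rw [chartVolume_apply x₀ (isOpen_chart_source x₀).measurableSet.compl]
  have : (extChartAt (𝓡 m) x₀).symm ⁻¹' (extChartAt (𝓡 m) x₀).sourceᶜ ∩
      (extChartAt (𝓡 m) x₀).target = ∅ := by
    ext y
    simp only [mem_inter_iff, mem_preimage, mem_compl_iff, mem_empty_iff_false, iff_false, not_and]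
    intro h hy
    exact h ((extChartAt (𝓡 m) x₀).map_target hy)
  rw [this]
  simp

theorem chartVolume_restrict_source (x₀ : M) :
    (chartVolume (m := m) x₀).restrict (extChartAt (𝓡 m) x₀).source = chartVolume (m := m) x₀ := by
  have h := Measure.restrict_add_restrict_compl (μ := chartVolume (m := m) x₀)
    (isOpen_chart_source (m := m) x₀).measurableSet
  rwa [Measure.restrict_eq_zero.2 (chartVolume_compl_source x₀), add_zero] at h

variable [IsManifold (𝓡 m) ∞ M]

/-- Change of variables along the transition map: its Jacobian |det D| is the factor relating the
two densities by `metricMatrix_transition`. -/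
theorem chartVolume_eq_of_subset {x₀ x₁ : M} {A : Set M} (hA : MeasurableSet A)
    (h0 : A ⊆ (extChartAt (𝓡 m) x₀).source) (h1 : A ⊆ (extChartAt (𝓡 m) x₁).source) :
    chartVolume (m := m) x₀ A = chartVolume (m := m) x₁ A := by
  rw [chartVolume_apply x₀ hA, chartVolume_apply x₁ hA]
  set S₀ := (extChartAt (𝓡 m) x₀).symm ⁻¹' A ∩ (extChartAt (𝓡 m) x₀).target
  set S₁ := (extChartAt (𝓡 m) x₁).symm ⁻¹' A ∩ (extChartAt (𝓡 m) x₁).target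
  have himg : S₁ = transition x₀ x₁ '' S₀ := by
    ext z
    constructor
    · rintro ⟨hzA, hz⟩
      refine ⟨extChartAt (𝓡 m) x₀ ((extChartAt (𝓡 m) x₁).symm z), ⟨?_, ?_⟩, ?_⟩
      · rw [mem_preimage, (extChartAt (𝓡 m) x₀).left_inv (h0 hzA)]
        exact hzA
      · exact (extChartAt (𝓡 m) x₀).map_source (h0 hzA)
      · simp only [transition, coordRep, id]
        rw [(extChartAt (𝓡 m) x₀).left_inv (h0 hzA), (extChartAt (𝓡 m) x₁).right_inv hz]
    · rintro ⟨y, ⟨hyA, hy⟩, rfl⟩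
      refine ⟨?_, (extChartAt (𝓡 m) x₁).map_source (h1 hyA)⟩
      simp only [transition, coordRep, id, mem_preimage]
      rw [(extChartAt (𝓡 m) x₁).left_inv (h1 hyA)]
      exact hyA
  have hd : ∀ y ∈ S₀, HasFDerivWithinAt (transition x₀ x₁) (fderiv ℝ (transition x₀ x₁) y) S₀ y :=
    fun y hy => ((contDiffAt_coordRep (f := id) hy.2 contMDiffAt_id (h1 hy.1)).differentiableAt
      (by simp)).hasFDerivAt.hasFDerivWithinAt
  have hinj : InjOn (transition x₀ x₁) S₀ := by
    intro y hy z hz hyz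
    simp only [transition, coordRep, id] at hyz
    have := (extChartAt (𝓡 m) x₁).injOn (h1 hy.1) (h1 hz.1) hyz
    exact (extChartAt (𝓡 m) x₀).symm.injOn hy.2 hz.2 this
  rw [himg, lintegral_image_eq_lintegral_abs_det_fderiv_mul volume
    (measurableSet_chart_preimage x₀ hA) hd hinj]
  refine setLIntegral_congr_fun (measurableSet_chart_preimage x₀ hA) fun y hy => ?_
  beta_reduce
  rw [metricMatrix_transition hy.2 (h1 hy.1), Matrix.det_mul, Matrix.det_mul,
    Matrix.det_transpose, LinearMap.det_toMatrix, ← ENNReal.ofReal_mul (abs_nonneg _)]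
  congr 1
  rw [mul_right_comm, Real.sqrt_mul (mul_self_nonneg _), Real.sqrt_mul_self_eq_abs]

/-- On the domain of a chart, the Riemannian volume is given by the density `√det g`. -/
theorem riemannianVolume_restrict_source (x₀ : M) :
    (riemannianVolume m M).restrict (extChartAt (𝓡 m) x₀).source = chartVolume (m := m) x₀ := by
  have hs := (isOpen_chart_source (m := m) x₀).measurableSet
  apply le_antisymm
  -- Each chart volume is split along the domain at `x₀`: inside it is bounded by `chartVolume x₀`,
  -- outside by the supremum. Restriction to the domain then removes the second term.
  · have hle : riemannianVolume m M ≤ chartVolume (m := m) x₀ +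
        (riemannianVolume m M).restrict (extChartAt (𝓡 m) x₀).sourceᶜ := by
      refine iSup_le fun x₁ => ?_
      rw [← Measure.restrict_add_restrict_compl (μ := chartVolume (m := m) x₁) hs]
      refine add_le_add ?_ (Measure.restrict_mono_measure (le_iSup (chartVolume (m := m)) x₁) _)
      refine Measure.le_iff.2 fun A hA => ?_
      rw [Measure.restrict_apply hA]
      have hA' := hA.inter hs
      have e1 : chartVolume (m := m) x₁ (A ∩ (extChartAt (𝓡 m) x₀).source) =
          chartVolume (m := m) x₁ (A ∩ (extChartAt (𝓡 m) x₀).source ∩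
            (extChartAt (𝓡 m) x₁).source) := by
        conv_lhs => rw [← chartVolume_restrict_source x₁]
        rw [Measure.restrict_apply hA']
      rw [e1, chartVolume_eq_of_subset (hA'.inter (isOpen_chart_source (m := m) x₁).measurableSet)
        (x₁ := x₀) inter_subset_right (inter_subset_left.trans inter_subset_right)]
      exact measure_mono (inter_subset_left.trans inter_subset_left)
    have h2 := Measure.restrict_mono_measure hle (extChartAt (𝓡 m) x₀).source
    rw [Measure.restrict_add, Measure.restrict_restrict hs, inter_compl_self,
      Measure.restrict_empty, add_zero, chartVolume_restrict_source] at h2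
    exact h2
  · rw [← chartVolume_restrict_source x₀]
    exact Measure.restrict_mono_measure (le_iSup (chartVolume (m := m)) x₀) _

end Measurability

variable [IsManifold (𝓡 m) ∞ M]
  [RiemannianBundle (fun x : M => TangentSpace (𝓡 m) x)]
  [IsContMDiffRiemannianBundle (𝓡 m) ∞ (EuclideanSpace ℝ (Fin m))
      (fun x : M => TangentSpace (𝓡 m) x)]

theorem continuousOn_sqrt_det_metricMatrix (x₀ : M) :
    ContinuousOn (fun y => Real.sqrt (metricMatrix x₀ y).det) (extChartAt (𝓡 m) x₀).target :=
  (contDiffOn_det (n := 0) fun i j =>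
    contDiffOn_zero.2 (continuousOn_metricMatrix x₀ i j)).continuousOn.sqrt

theorem aemeasurable_density (x₀ : M) :
    AEMeasurable (fun y => ENNReal.ofReal (Real.sqrt (metricMatrix x₀ y).det))
      (volume.restrict (extChartAt (𝓡 m) x₀).target) :=
  ((continuousOn_sqrt_det_metricMatrix x₀).aemeasurable
    (isOpen_chart_target x₀).measurableSet).ennreal_ofReal

variable [MeasurableSpace M] [BorelSpace M]

/-- The density is bounded on closed coordinate balls, so the measure is locally finite, hence
finite on a compact space. -/
theorem isFiniteMeasure_riemannianVolume [CompactSpace M] :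
    IsFiniteMeasure (riemannianVolume m M) := by
  have hloc : IsLocallyFiniteMeasure (riemannianVolume m M) := by
    refine ⟨fun x => ?_⟩
    have hx : extChartAt (𝓡 m) x x ∈ (extChartAt (𝓡 m) x).target := mem_extChartAt_target x
    obtain ⟨r, hr, hrt⟩ := Metric.nhds_basis_closedBall.mem_iff.1
      ((isOpen_chart_target x).mem_nhds hx)
    set A := (extChartAt (𝓡 m) x).source ∩
      extChartAt (𝓡 m) x ⁻¹' Metric.ball (extChartAt (𝓡 m) x x) r
    have hAo : IsOpen A := (continuousOn_extChartAt (I := 𝓡 m) x).isOpen_inter_preimage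
      (isOpen_chart_source x) Metric.isOpen_ball
    refine ⟨A, hAo.mem_nhds ⟨mem_extChartAt_source x, Metric.mem_ball_self hr⟩, ?_⟩
    have e1 : riemannianVolume m M A = chartVolume (m := m) x A := by
      rw [← riemannianVolume_restrict_source x, Measure.restrict_apply hAo.measurableSet,
        inter_eq_left.2 inter_subset_left]
    rw [e1, chartVolume_apply x hAo.measurableSet]
    obtain ⟨C, hC⟩ := (isCompact_closedBall (extChartAt (𝓡 m) x x) r).exists_bound_of_continuousOn
      ((continuousOn_sqrt_det_metricMatrix x).mono hrt)
    have hsub : (extChartAt (𝓡 m) x).symm ⁻¹' A ∩ (extChartAt (𝓡 m) x).target ⊆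
        Metric.closedBall (extChartAt (𝓡 m) x x) r := by
      rintro y ⟨⟨-, hyA⟩, hy⟩
      rw [mem_preimage, (extChartAt (𝓡 m) x).right_inv hy] at hyA
      exact Metric.ball_subset_closedBall hyA
    calc _ ≤ ∫⁻ y in Metric.closedBall (extChartAt (𝓡 m) x x) r,
          ENNReal.ofReal (Real.sqrt (metricMatrix x y).det) := lintegral_mono_set hsub
      _ ≤ ∫⁻ y in Metric.closedBall (extChartAt (𝓡 m) x x) r, ENNReal.ofReal C :=
          setLIntegral_mono' Metric.isClosed_closedBall.measurableSet fun y hy =>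
            ENNReal.ofReal_le_ofReal ((le_abs_self _).trans (hC y hy))
      _ < ⊤ := by
          rw [setLIntegral_const]
          exact ENNReal.mul_lt_top ENNReal.ofReal_lt_top measure_closedBall_lt_top
  exact CompactSpace.isFiniteMeasure

end Volume

/-! ### Invariance of the pairing under changes within one coordinate ball. -/

section Variation

open Topology Set MeasureTheory

variable {m : ℕ} {M : Type*} [TopologicalSpace M]
  [ChartedSpace (EuclideanSpace ℝ (Fin m)) M]

/-- The integral of the pairing of `f^*σ` with `σ`. -/
def pairing [RiemannianBundle (fun x : M => TangentSpace (𝓡 m) x)] [MeasurableSpace M]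
    (σ : SymplecticForm m M) (f : M → M) : ℝ :=
  ∫ x, formInner (formPullback (m := m) f σ.form x) (σ.form x) ∂(riemannianVolume m M)

theorem pairing_of_formPullback_eq [RiemannianBundle (fun x : M => TangentSpace (𝓡 m) x)]
    [MeasurableSpace M] {σ : SymplecticForm m M} {f : M → M}
    (hf : formPullback (m := m) f σ.form = σ.form) :
    pairing σ f = ∫ x, normSqTwoForm (σ.form x) ∂(riemannianVolume m M) := by
  rw [pairing, hf]
  simp only [formInner_self]

theorem formPullback_eq_of_eventuallyEq {k : ℕ} (α : FormField m k M) {f f' : M → M} {x : M}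
    (h : f =ᶠ[𝓝 x] f') : formPullback (m := m) f α x = formPullback (m := m) f' α x := by
  have hd : (mfderiv (𝓡 m) (𝓡 m) f x : EuclideanSpace ℝ (Fin m) →L[ℝ] EuclideanSpace ℝ (Fin m)) =
      mfderiv (𝓡 m) (𝓡 m) f' x := h.mfderiv_eq
  ext v
  refine Eq.trans ?_ (form_apply_congr α h.eq_of_nhds _)
  exact congrArg (α (f x)) (funext fun i => congrArg (fun L : EuclideanSpace ℝ (Fin m) →L[ℝ]
    EuclideanSpace ℝ (Fin m) => L (v i)) hd)

variable [IsManifold (𝓡 m) ∞ M]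

/-- In coordinates, the difference of the pullbacks of a closed 2-form under two maps that take
values in a coordinate ball and agree off a compact set is exact, with a primitive supported in
this compact set. -/
theorem exists_primitive_pullback_sub (σ : SymplecticForm m M) {f f' : M → M}
    (hf : ContMDiff (𝓡 m) (𝓡 m) ∞ f) (hf' : ContMDiff (𝓡 m) (𝓡 m) ∞ f') {x₀ y₀ : M}
    {c : EuclideanSpace ℝ (Fin m)} {r : ℝ} (hr : 0 < r)
    (hcr : Metric.closedBall c r ⊆ (extChartAt (𝓡 m) y₀).target)
    {V K : Set (EuclideanSpace ℝ (Fin m))} (hV : V ⊆ (extChartAt (𝓡 m) x₀).target)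
    (hKc : IsClosed K)
    (hVf : ∀ y ∈ V, f ((extChartAt (𝓡 m) x₀).symm y) ∈
      (extChartAt (𝓡 m) y₀).source ∩ extChartAt (𝓡 m) y₀ ⁻¹' Metric.ball c r)
    (hVf' : ∀ y ∈ V, f' ((extChartAt (𝓡 m) x₀).symm y) ∈
      (extChartAt (𝓡 m) y₀).source ∩ extChartAt (𝓡 m) y₀ ⁻¹' Metric.ball c r)
    (hff' : ∀ y ∈ (extChartAt (𝓡 m) x₀).target, y ∉ K →
      f ((extChartAt (𝓡 m) x₀).symm y) = f' ((extChartAt (𝓡 m) x₀).symm y)) :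
    ∃ β : EuclideanSpace ℝ (Fin m) → EuclideanSpace ℝ (Fin m) →L[ℝ] ℝ, ContDiffOn ℝ 1 β V ∧
      (∀ y ∈ V, y ∉ K → β y = 0) ∧ ∀ y ∈ V, ∀ i j,
        fderiv ℝ β y (stdVec m i) (stdVec m j) - fderiv ℝ β y (stdVec m j) (stdVec m i) =
          twoFormMatrix (chartForm (formPullback (m := m) f' σ.form) x₀ y) (stdVec m) i j -
          twoFormMatrix (chartForm (formPullback (m := m) f σ.form) x₀ y) (stdVec m) i j := by
  obtain ⟨lam, hlam, hcurl⟩ := exists_primitive_on_ball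
    (B := fun y => twoFormCLM (chartForm σ.form y₀ y)) (isOpen_chart_target y₀)
    (contDiffOn_twoFormCLM (σ.smooth y₀))
    (fun y _ u v => by simp only [twoFormCLM_apply]; exact twoForm_swap _ _ _)
    (fun y hy u v w => cyclic_fderiv_twoFormCLM (isOpen_chart_target y₀) (σ.smooth y₀)
      (σ.closed y₀) hy u v w) hr hcr
  have hrep : ∀ g : M → M, ContMDiff (𝓡 m) (𝓡 m) ∞ g → (∀ y ∈ V,
      g ((extChartAt (𝓡 m) x₀).symm y) ∈
        (extChartAt (𝓡 m) y₀).source ∩ extChartAt (𝓡 m) y₀ ⁻¹' Metric.ball c r) → ∀ y ∈ V,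
      ContDiffAt ℝ 1 (fun y => (lam (coordRep g x₀ y₀ y)).comp (fderiv ℝ (coordRep g x₀ y₀) y)) y ∧
      ∀ i j, fderiv ℝ (fun y => (lam (coordRep g x₀ y₀ y)).comp (fderiv ℝ (coordRep g x₀ y₀) y)) y
          (stdVec m i) (stdVec m j) -
        fderiv ℝ (fun y => (lam (coordRep g x₀ y₀ y)).comp (fderiv ℝ (coordRep g x₀ y₀) y)) y
          (stdVec m j) (stdVec m i) =
        twoFormMatrix (chartForm (formPullback (m := m) g σ.form) x₀ y) (stdVec m) i j := by
    intro g hg hVg y hy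
    have hr := contDiffAt_coordRep (hV hy) hg.contMDiffAt (hVg y hy).1
    refine ⟨?_, fun i j => ?_⟩
    · exact (hlam.contDiffAt.comp y (hr.of_le (by norm_cast))).clm_comp
        (hr.fderiv_right (m := 1) (by norm_cast))
    · refine (curl_pullback (hlam.differentiable one_ne_zero _) hr _ _).trans
        ((hcurl (coordRep g x₀ y₀ y) (hVg y hy).2 _ _).trans ?_)
      exact (twoFormMatrix_chartForm_formPullback σ.form (hV hy) hg.contMDiffAt
        (hVg y hy).1 i j).symm
  -- With σ = dλ on the ball, β = f'^*λ - f^*λ, which vanishes wherever the two maps agree locally.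
  refine ⟨fun y => (lam (coordRep f' x₀ y₀ y)).comp (fderiv ℝ (coordRep f' x₀ y₀) y) -
    (lam (coordRep f x₀ y₀ y)).comp (fderiv ℝ (coordRep f x₀ y₀) y), fun y hy => ?_,
    fun y hy hyK => ?_, fun y hy i j => ?_⟩
  · exact ((hrep f' hf' hVf' y hy).1.sub (hrep f hf hVf y hy).1).contDiffWithinAt
  · have heq : coordRep f' x₀ y₀ =ᶠ[𝓝 y] coordRep f x₀ y₀ := by
      filter_upwards [(isOpen_chart_target x₀).mem_nhds (hV hy), hKc.isOpen_compl.mem_nhds hyK]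
        with z hz hzK
      simp only [coordRep, hff' z hz hzK]
    simp only [heq.fderiv_eq, heq.eq_of_nhds, sub_self]
  · rw [← (hrep f' hf' hVf' y hy).2, ← (hrep f hf hVf y hy).2,
      fderiv_fun_sub ((hrep f' hf' hVf' y hy).1.differentiableAt one_ne_zero)
        ((hrep f hf hVf y hy).1.differentiableAt one_ne_zero)]
    simp only [_root_.sub_apply]
    ring

variable [RiemannianBundle (fun x : M => TangentSpace (𝓡 m) x)]
  [IsContMDiffRiemannianBundle (𝓡 m) ∞ (EuclideanSpace ℝ (Fin m))
      (fun x : M => TangentSpace (𝓡 m) x)]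

theorem continuous_formInner_formPullback {σ : SymplecticForm m M} {f : M → M}
    (hf : ContMDiff (𝓡 m) (𝓡 m) ∞ f) :
    Continuous fun x => formInner (formPullback (m := m) f σ.form x) (σ.form x) :=
  continuous_formInner (σ.smooth.hasContinuousCoords_formPullback hf) σ.smooth.hasContinuousCoords

variable [MeasurableSpace M] [BorelSpace M]

/-- Integration of a function that vanishes off a chart domain. -/
theorem integral_riemannianVolume_eq {D : M → ℝ} (hD : Continuous D) (x₀ : M)
    (h0 : ∀ x, x ∉ (extChartAt (𝓡 m) x₀).source → D x = 0) :
    ∫ x, D x ∂(riemannianVolume m M) = ∫ y in (extChartAt (𝓡 m) x₀).target,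
      D ((extChartAt (𝓡 m) x₀).symm y) * Real.sqrt (metricMatrix x₀ y).det := by
  rw [← setIntegral_eq_integral_of_forall_compl_eq_zero h0, riemannianVolume_restrict_source,
    chartVolume, integral_map (aemeasurable_chart_symm x₀ _) hD.aestronglyMeasurable,
    integral_withDensity_eq_integral_toReal_smul₀ (aemeasurable_density x₀)
      (Filter.Eventually.of_forall fun _ => ENNReal.ofReal_lt_top)]
  refine integral_congr_ae (Filter.Eventually.of_forall fun y => ?_)
  simp only [ENNReal.toReal_ofReal (Real.sqrt_nonneg _), smul_eq_mul, mul_comm]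

variable {σ : SymplecticForm m M}

theorem integrable_riemannianVolume [CompactSpace M] {D : M → ℝ} (hD : Continuous D) :
    Integrable D (riemannianVolume m M) := by
  have := isFiniteMeasure_riemannianVolume (m := m) (M := M)
  exact hD.integrable_of_hasCompactSupport (HasCompactSupport.of_compactSpace D)

theorem integrable_normSqTwoForm [CompactSpace M] {α : FormField m 2 M}
    (hα : HasContinuousCoords α) :
    Integrable (fun x => normSqTwoForm (α x)) (riemannianVolume m M) := by
  simp only [← formInner_self]
  exact integrable_riemannianVolume (continuous_formInner hα hα)

theorem two_mul_pairing_sub_le [CompactSpace M] {f : M → M} (hf : ContMDiff (𝓡 m) (𝓡 m) ∞ f) :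
    2 * pairing σ f - ∫ x, normSqTwoForm (σ.form x) ∂(riemannianVolume m M) ≤
      ∫ x, normSqTwoForm (formPullback (m := m) f σ.form x) ∂(riemannianVolume m M) := by
  have hcσ := σ.smooth.hasContinuousCoords
  have hcf := σ.smooth.hasContinuousCoords_formPullback hf
  have hσi := integrable_normSqTwoForm hcσ
  have hpi : Integrable (fun x => 2 * formInner (formPullback (m := m) f σ.form x) (σ.form x))
      (riemannianVolume m M) :=
    (integrable_riemannianVolume (continuous_formInner hcf hcσ)).const_mul 2
  rw [pairing, ← integral_const_mul, ← integral_sub hpi hσi]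
  exact integral_mono (hpi.sub hσi) (integrable_normSqTwoForm hcf) fun x =>
    two_mul_formInner_sub_le (formPullback (m := m) f σ.form x) (σ.form x)

/-- The difference of the pairings is the integral of ⟨dβ, σ⟩ over a chart, with β supported in the
image of `K`; it vanishes because σ is coclosed. -/
theorem pairing_eq_of_eqOn_compl [CompactSpace M] [T2Space M] (hσ : IsCompatible σ) {f f' : M → M}
    (hf : ContMDiff (𝓡 m) (𝓡 m) ∞ f) (hf' : ContMDiff (𝓡 m) (𝓡 m) ∞ f') {x₀ y₀ : M}
    {c : EuclideanSpace ℝ (Fin m)} {r : ℝ} (hr : 0 < r)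
    (hcr : Metric.closedBall c r ⊆ (extChartAt (𝓡 m) y₀).target)
    {K : Set M} (hK : IsCompact K) (hKs : K ⊆ (extChartAt (𝓡 m) x₀).source)
    (hKf : MapsTo f K ((extChartAt (𝓡 m) y₀).source ∩ extChartAt (𝓡 m) y₀ ⁻¹' Metric.ball c r))
    (hKf' : MapsTo f' K ((extChartAt (𝓡 m) y₀).source ∩ extChartAt (𝓡 m) y₀ ⁻¹' Metric.ball c r))
    (hff' : EqOn f f' Kᶜ) : pairing σ f = pairing σ f' := by
  set D : M → ℝ := fun x => formInner (formPullback (m := m) f' σ.form x) (σ.form x) -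
    formInner (formPullback (m := m) f σ.form x) (σ.form x)
  have hD : Continuous D :=
    (continuous_formInner_formPullback hf').sub (continuous_formInner_formPullback hf)
  have hD0 : ∀ x, x ∉ K → D x = 0 := fun x hx => by
    simp only [D]
    rw [formPullback_eq_of_eventuallyEq σ.form
      (hff'.eventuallyEq_of_mem (hK.isClosed.isOpen_compl.mem_nhds hx)), sub_self]
  suffices h : ∫ x, D x ∂(riemannianVolume m M) = 0 by
    rw [integral_sub (integrable_riemannianVolume (continuous_formInner_formPullback hf'))
      (integrable_riemannianVolume (continuous_formInner_formPullback hf))] at h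
    exact (sub_eq_zero.1 h).symm
  rw [integral_riemannianVolume_eq hD x₀ fun x hx => hD0 x fun h => hx (hKs h)]
  set B := (extChartAt (𝓡 m) y₀).source ∩ extChartAt (𝓡 m) y₀ ⁻¹' Metric.ball c r
  have hB : IsOpen B := (continuousOn_extChartAt (I := 𝓡 m) y₀).isOpen_inter_preimage
    (isOpen_chart_source y₀) Metric.isOpen_ball
  set T := (extChartAt (𝓡 m) x₀).target
  have hT : IsOpen T := isOpen_chart_target x₀
  -- The primitive of σ lives only on the coordinate ball, so integration is confined to the points
  -- that both maps send there. This open set contains the image of `K`.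
  set V := T ∩ (extChartAt (𝓡 m) x₀).symm ⁻¹' (f ⁻¹' B ∩ f' ⁻¹' B)
  have hV : IsOpen V := (continuousOn_extChartAt_symm (I := 𝓡 m) x₀).isOpen_inter_preimage hT
    ((hB.preimage hf.continuous).inter (hB.preimage hf'.continuous))
  have hVT : V ⊆ T := inter_subset_left
  set K' := extChartAt (𝓡 m) x₀ '' K
  have hK' : IsCompact K' := hK.image_of_continuousOn
    ((continuousOn_extChartAt (I := 𝓡 m) x₀).mono hKs)
  have hK'V : K' ⊆ V := by
    rintro _ ⟨x, hx, rfl⟩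
    refine ⟨(extChartAt (𝓡 m) x₀).map_source (hKs hx), ?_⟩
    rw [mem_preimage, (extChartAt (𝓡 m) x₀).left_inv (hKs hx)]
    exact ⟨hKf hx, hKf' hx⟩
  have hnK : ∀ y ∈ T, y ∉ K' → (extChartAt (𝓡 m) x₀).symm y ∉ K := fun y hy hyK h =>
    hyK ⟨_, h, (extChartAt (𝓡 m) x₀).right_inv hy⟩
  rw [setIntegral_eq_of_subset_of_forall_sdiff_eq_zero hT.measurableSet hVT fun y hy => by
    rw [hD0 _ (hnK y hy.1 fun h => hy.2 (hK'V h)), zero_mul]]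
  obtain ⟨β, hβ, hβ0, hcurl⟩ := exists_primitive_pullback_sub σ hf hf' hr hcr hVT hK'.isClosed
    (fun y hy => hy.2.1) (fun y hy => hy.2.2) fun y hy hyK => hff' (hnK y hy hyK)
  set w := fun y => twoFormMatrix (chartForm σ.form x₀ y) (stdVec m)
  rw [← setIntegral_trace_curl_mul_inv_eq_zero (μ := volume) (stdVec m) hV hK' hK'V (w := w)
    (fun i j => ((σ.smooth.contDiffOn_apply x₀ ![stdVec m i, stdVec m j]).mono hVT).of_le
      (by norm_cast))
    (fun y hy => det_chartForm_ne_zero hσ x₀ (hVT hy))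
    (fun y _ i j => twoForm_swap (chartForm σ.form x₀ y) (stdVec m i) (stdVec m j))
    (fun y hy i j k => cyclic_fderiv_of_extDeriv_eq_zero
      (((σ.smooth x₀).contDiffAt (hT.mem_nhds (hVT hy))).differentiableAt (by simp))
      (σ.closed x₀ y (hVT hy)) _ _ _) hβ hβ0]
  refine setIntegral_congr_fun hV.measurableSet fun y hy => ?_
  simp only [D]
  rw [formInner_symplectic_eq_trace hσ (formPullback (m := m) f' σ.form) x₀ (hVT hy),
    formInner_symplectic_eq_trace hσ (formPullback (m := m) f σ.form) x₀ (hVT hy),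
    det_metricMatrix hσ x₀ (hVT hy), ← mul_sub, ← Matrix.trace_sub, ← Matrix.sub_mul]
  congr 4
  ext i j
  exact (hcurl y hy i j).symm

end Variation

/-! ### Cut-off modification of a map inside a coordinate ball. -/

section Modification

open Topology Set

variable {m : ℕ} {M : Type*} [TopologicalSpace M]
  [ChartedSpace (EuclideanSpace ℝ (Fin m)) M]

/-- The set of points of the chart domain at `y₀` whose coordinates lie in a ball. -/
def coordBall (y₀ : M) (c : EuclideanSpace ℝ (Fin m)) (r : ℝ) : Set M :=
  (extChartAt (𝓡 m) y₀).source ∩ extChartAt (𝓡 m) y₀ ⁻¹' Metric.ball c r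

theorem isOpen_coordBall (y₀ : M) (c : EuclideanSpace ℝ (Fin m)) (r : ℝ) :
    IsOpen (coordBall y₀ c r) :=
  (continuousOn_extChartAt (I := 𝓡 m) y₀).isOpen_inter_preimage
    (isOpen_chart_source y₀) Metric.isOpen_ball

open Classical in
/-- The map `f`, moved towards the map with coordinate expression `s` in the chart at `y₀`, where
the cut-off function `χ` does not vanish. -/
def modify (χ : M → ℝ) (y₀ : M) (s : M → EuclideanSpace ℝ (Fin m)) (f : M → M) (z : M) : M :=
  if χ z = 0 then f z else
    (extChartAt (𝓡 m) y₀).symm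
      (extChartAt (𝓡 m) y₀ (f z) + χ z • (s z - extChartAt (𝓡 m) y₀ (f z)))

theorem modify_of_eq_zero {χ : M → ℝ} {z : M} (h : χ z = 0) (y₀ : M)
    (s : M → EuclideanSpace ℝ (Fin m)) (f : M → M) : modify χ y₀ s f z = f z := if_pos h

/-- On the preimage of the chart domain the case distinction is redundant, so regularity there
follows from a single formula. -/
theorem modify_of_mem_source {χ : M → ℝ} {y₀ z : M} {f : M → M}
    (h : f z ∈ (extChartAt (𝓡 m) y₀).source) (s : M → EuclideanSpace ℝ (Fin m)) :
    modify χ y₀ s f z = (extChartAt (𝓡 m) y₀).symm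
      (extChartAt (𝓡 m) y₀ (f z) + χ z • (s z - extChartAt (𝓡 m) y₀ (f z))) := by
  by_cases hz : χ z = 0
  · rw [modify_of_eq_zero hz, hz, zero_smul, add_zero, (extChartAt (𝓡 m) y₀).left_inv h]
  · exact if_neg hz

theorem tendsto_modification (h : C(M, M)) {χ : M → ℝ} (hχ : Continuous χ) {y₀ x : M}
    (hx : h x ∈ (extChartAt (𝓡 m) y₀).source) [LocallyCompactSpace M] :
    Filter.Tendsto (fun p : (C(M, M) × EuclideanSpace ℝ (Fin m)) × M =>
      extChartAt (𝓡 m) y₀ (p.1.1 p.2) + χ p.2 • p.1.2) (𝓝 ((h, 0), x))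
      (𝓝 (extChartAt (𝓡 m) y₀ (h x))) := by
  have h1 : Continuous fun p : (C(M, M) × EuclideanSpace ℝ (Fin m)) × M => p.1.1 p.2 := by
    fun_prop
  have h2 : Filter.Tendsto (fun p : (C(M, M) × EuclideanSpace ℝ (Fin m)) × M =>
      extChartAt (𝓡 m) y₀ (p.1.1 p.2)) (𝓝 ((h, 0), x)) (𝓝 (extChartAt (𝓡 m) y₀ (h x))) :=
    Filter.Tendsto.comp (continuousAt_extChartAt' (by simpa using hx)) h1.continuousAt
  have h3 : Continuous fun p : (C(M, M) × EuclideanSpace ℝ (Fin m)) × M => χ p.2 • p.1.2 := by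
    fun_prop
  have h4 := h2.add (h3.tendsto ((h, 0), x))
  simpa using h4

variable [IsManifold (𝓡 m) ∞ M]

theorem contMDiffAt_modify {n : WithTop ℕ∞} (hn : n ≤ ∞) {χ : M → ℝ}
    (hχ : ContMDiff (𝓡 m) 𝓘(ℝ) ∞ χ) {y₀ x : M} {s : M → EuclideanSpace ℝ (Fin m)} {f : M → M}
    (hf : ContMDiffAt (𝓡 m) (𝓡 m) n f x)
    (hs : x ∈ tsupport χ → ContMDiffAt (𝓡 m) 𝓘(ℝ, EuclideanSpace ℝ (Fin m)) n s x)
    (hfx : x ∈ tsupport χ → f x ∈ (extChartAt (𝓡 m) y₀).source)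
    (hx : x ∈ tsupport χ → extChartAt (𝓡 m) y₀ (f x) + χ x • (s x - extChartAt (𝓡 m) y₀ (f x)) ∈
      (extChartAt (𝓡 m) y₀).target) :
    ContMDiffAt (𝓡 m) (𝓡 m) n (modify χ y₀ s f) x := by
  by_cases h : x ∈ tsupport χ
  · have heq : modify χ y₀ s f =ᶠ[𝓝 x] fun z => (extChartAt (𝓡 m) y₀).symm
        (extChartAt (𝓡 m) y₀ (f z) + χ z • (s z - extChartAt (𝓡 m) y₀ (f z))) := by
      filter_upwards [hf.continuousAt.preimage_mem_nhds
        ((isOpen_chart_source y₀).mem_nhds (hfx h))] with z hz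
      exact modify_of_mem_source hz s
    refine ContMDiffAt.congr_of_eventuallyEq ?_ heq
    have h1 : ContMDiffAt (𝓡 m) 𝓘(ℝ, EuclideanSpace ℝ (Fin m)) n
        (fun z => extChartAt (𝓡 m) y₀ (f z)) x :=
      ((contMDiffAt_chart (hfx h)).of_le hn).comp x hf
    exact ((contMDiffAt_chart_symm (hx h)).of_le hn).comp x
      (h1.add ((hχ.contMDiffAt.of_le hn).smul ((hs h).sub h1)))
  · refine hf.congr_of_eventuallyEq ?_
    filter_upwards [(isClosed_tsupport χ).isOpen_compl.mem_nhds h] with z hz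
    exact modify_of_eq_zero (image_eq_zero_of_notMem_tsupport hz) y₀ s f

/-- Where χ = 1 the modified map has coordinates `s`; its smoothness needs only continuity of `f`.
-/
theorem contMDiffAt_modify_of_eventuallyEq_one {χ : M → ℝ} {y₀ x : M}
    {s : M → EuclideanSpace ℝ (Fin m)} {f : M → M} (hf : Continuous f) (h1 : χ =ᶠ[𝓝 x] 1)
    (hs : ContMDiffAt (𝓡 m) 𝓘(ℝ, EuclideanSpace ℝ (Fin m)) ∞ s x)
    (hfx : f x ∈ (extChartAt (𝓡 m) y₀).source) (hx : s x ∈ (extChartAt (𝓡 m) y₀).target) :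
    ContMDiffAt (𝓡 m) (𝓡 m) ∞ (modify χ y₀ s f) x := by
  have heq : modify χ y₀ s f =ᶠ[𝓝 x] fun z => (extChartAt (𝓡 m) y₀).symm (s z) := by
    filter_upwards [h1, hf.continuousAt.preimage_mem_nhds
      ((isOpen_chart_source y₀).mem_nhds hfx)] with z hz hz'
    rw [modify_of_mem_source hz' s, hz, Pi.one_apply, one_smul, add_sub_cancel]
  exact ((contMDiffAt_chart_symm hx).comp x hs).congr_of_eventuallyEq heq

/-- One step of an induction over charts: it keeps smoothness already gained, gains it where χ = 1,
and stays in a prescribed neighbourhood of `h`. The displacement of `f z` towards `s z` is treated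
as a free small vector, so that compactness of the support gives conditions uniform in `z`. -/
theorem exists_local_modification [CompactSpace M] [T2Space M] (h : C(M, M)) {χ : M → ℝ}
    (hχ : ContMDiff (𝓡 m) 𝓘(ℝ) ∞ χ) {y₀ : M} {c : EuclideanSpace ℝ (Fin m)} {r : ℝ}
    (hcr : Metric.closedBall c r ⊆ (extChartAt (𝓡 m) y₀).target)
    (hK : MapsTo h (tsupport χ) (coordBall y₀ c r)) {U : Set C(M, M)} (hU : U ∈ 𝓝 h) :
    ∃ V ∈ 𝓝 h, ∃ ε > 0, ∀ f ∈ V, MapsTo f (tsupport χ) (coordBall y₀ c r) ∧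
      ∀ s : M → EuclideanSpace ℝ (Fin m),
        (∀ z ∈ tsupport χ, ContMDiffAt (𝓡 m) 𝓘(ℝ, EuclideanSpace ℝ (Fin m)) ∞ s z) →
      (∀ z ∈ tsupport χ, ‖s z - extChartAt (𝓡 m) y₀ (f z)‖ < ε) →
      ∃ f' ∈ U, (f' : M → M) = modify χ y₀ s f ∧ MapsTo f' (tsupport χ) (coordBall y₀ c r) ∧
        (∀ x, ContMDiffAt (𝓡 m) (𝓡 m) ∞ f x → ContMDiffAt (𝓡 m) (𝓡 m) ∞ f' x) ∧
        ∀ x, χ =ᶠ[𝓝 x] 1 → ContMDiffAt (𝓡 m) (𝓡 m) ∞ f' x := by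
  have hKc : IsCompact (tsupport χ) := (isClosed_tsupport χ).isCompact
  obtain ⟨S, ⟨hSf, hS⟩, hSU⟩ := h.hasBasis_nhds.mem_iff.1 hU
  have hball : ∀ᶠ f : C(M, M) in 𝓝 h, MapsTo f (tsupport χ) (coordBall y₀ c r) :=
    ContinuousMap.eventually_mapsTo hKc (isOpen_coordBall y₀ c r) hK
  have hcore : ∀ᶠ p : C(M, M) × EuclideanSpace ℝ (Fin m) in 𝓝 (h, 0), ∀ z ∈ tsupport χ,
      extChartAt (𝓡 m) y₀ (p.1 z) + χ z • p.2 ∈ Metric.ball c r := by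
    refine hKc.eventually_forall_of_forall_eventually
      (P := fun (p : C(M, M) × EuclideanSpace ℝ (Fin m)) z =>
        extChartAt (𝓡 m) y₀ (p.1 z) + χ z • p.2 ∈ Metric.ball c r) fun x hx => ?_
    exact tendsto_modification h hχ.continuous (hK hx).1 (Metric.isOpen_ball.mem_nhds (hK hx).2)
  -- Membership in `U` is tested on finitely many compact-open conditions; each is required of the
  -- unmodified map, for points off the support, and of the displaced point on the support.
  have hopen : ∀ᶠ p : C(M, M) × EuclideanSpace ℝ (Fin m) in 𝓝 (h, 0), ∀ CU ∈ S,
      MapsTo p.1 CU.1 CU.2 ∧ ∀ z ∈ CU.1 ∩ tsupport χ, (extChartAt (𝓡 m) y₀).symm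
        (extChartAt (𝓡 m) y₀ (p.1 z) + χ z • p.2) ∈ CU.2 := by
    refine (Filter.eventually_all_finite hSf).2 fun CU hCU => ?_
    obtain ⟨hC, hO, hm⟩ := hS CU.1 CU.2 hCU
    refine Filter.Eventually.and ?_ ?_
    · exact (continuous_fst.tendsto (h, (0 : EuclideanSpace ℝ (Fin m)))).eventually
        (ContinuousMap.eventually_mapsTo hC hO hm)
    · refine (hC.inter_right (isClosed_tsupport χ)).eventually_forall_of_forall_eventually
        (P := fun (p : C(M, M) × EuclideanSpace ℝ (Fin m)) z => (extChartAt (𝓡 m) y₀).symm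
          (extChartAt (𝓡 m) y₀ (p.1 z) + χ z • p.2) ∈ CU.2) fun x hx => ?_
      have hs := (hK hx.2).1
      have h1 := Filter.Tendsto.comp (continuousAt_extChartAt_symm' (I := 𝓡 m) (by simpa using hs))
        (tendsto_modification h hχ.continuous hs)
      rw [(extChartAt (𝓡 m) y₀).left_inv hs] at h1
      exact h1 (hO.mem_nhds (hm hx.1))
  have hall := hcore.and hopen
  rw [nhds_prod_eq, Filter.eventually_prod_iff] at hall
  obtain ⟨P, hP, Q, hQ, hPQ⟩ := hall
  obtain ⟨ε, hε, hεQ⟩ := Metric.eventually_nhds_iff_ball.1 hQ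
  refine ⟨{f | P f} ∩ {f | MapsTo f (tsupport χ) (coordBall y₀ c r)}, Filter.inter_mem hP hball,
    ε, hε, fun f hf => ⟨hf.2, fun s hs hsf => ?_⟩⟩
  have hd : ∀ z ∈ tsupport χ, Q (s z - extChartAt (𝓡 m) y₀ (f z)) := fun z hz =>
    hεQ _ (by simpa using hsf z hz)
  have hmem : ∀ z ∈ tsupport χ, extChartAt (𝓡 m) y₀ (f z) +
      χ z • (s z - extChartAt (𝓡 m) y₀ (f z)) ∈ Metric.ball c r := fun z hz =>
    (hPQ hf.1 (hd z hz)).1 z hz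
  have htgt : Metric.ball c r ⊆ (extChartAt (𝓡 m) y₀).target :=
    Metric.ball_subset_closedBall.trans hcr
  have hcont : Continuous (modify χ y₀ s f) := by
    refine continuous_iff_continuousAt.2 fun x => ?_
    exact (contMDiffAt_modify (n := 0) (by simp) hχ
      (contMDiff_zero_iff.2 f.continuous).contMDiffAt (fun hx => (hs x hx).of_le (by simp))
      (fun hx => (hf.2 hx).1) fun hx => htgt (hmem x hx)).continuousAt
  refine ⟨⟨modify χ y₀ s f, hcont⟩, hSU ?_, rfl, fun z hz => ?_, fun x hx => ?_, fun x hx => ?_⟩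
  · refine mem_iInter₂.2 fun CU hCU z hz => ?_
    change modify χ y₀ s f z ∈ CU.2
    by_cases hzK : z ∈ tsupport χ
    · rw [modify_of_mem_source (hf.2 hzK).1]
      exact ((hPQ hf.1 (hd z hzK)).2 CU hCU).2 z ⟨hz, hzK⟩
    · rw [modify_of_eq_zero (image_eq_zero_of_notMem_tsupport hzK)]
      obtain ⟨ζ, hζ⟩ := hQ.exists
      exact ((hPQ hf.1 hζ).2 CU hCU).1 hz
  · change modify χ y₀ s f z ∈ _
    rw [modify_of_mem_source (hf.2 hz).1]
    refine ⟨(extChartAt (𝓡 m) y₀).map_target (htgt (hmem z hz)), ?_⟩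
    rw [mem_preimage, (extChartAt (𝓡 m) y₀).right_inv (htgt (hmem z hz))]
    exact hmem z hz
  · exact contMDiffAt_modify le_rfl hχ hx (hs x) (fun hx => (hf.2 hx).1) fun hx => htgt (hmem x hx)
  · have hxK : x ∈ tsupport χ := subset_tsupport _ (by simp [hx.eq_of_nhds])
    refine contMDiffAt_modify_of_eventuallyEq_one f.continuous hx (hs x hxK) (hf.2 hxK).1 (htgt ?_)
    have := hmem x hxK
    rwa [hx.eq_of_nhds, Pi.one_apply, one_smul, add_sub_cancel] at this

end Modification

/-! ### Smooth approximation, homotopy invariance of the pairing, and minimality. -/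

section Homotopy

open Topology Set MeasureTheory

variable {m : ℕ} {M : Type*} [TopologicalSpace M]

/-- Finitely many adapted bump functions, one of which equals `1` near any given point. -/
theorem exists_finset_bump [CompactSpace M] {χ : M → M → ℝ} (hχ : ∀ x, χ x =ᶠ[𝓝 x] 1) :
    ∃ t : Finset M, ∀ z, ∃ x ∈ t, χ x =ᶠ[𝓝 z] 1 := by
  obtain ⟨t, ht⟩ := CompactSpace.elim_nhds_subcover (fun x => {z | χ x =ᶠ[𝓝 z] 1})
    fun x => (hχ x).eventually_nhds
  refine ⟨t, fun z => ?_⟩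
  have hz : z ∈ ⋃ x ∈ t, {z | χ x =ᶠ[𝓝 z] 1} := ht ▸ mem_univ z
  simpa using hz

variable [ChartedSpace (EuclideanSpace ℝ (Fin m)) M]

theorem eventually_norm_coord_sub_lt [LocallyCompactSpace M] (h : C(M, M)) {K : Set M}
    (hK : IsCompact K) {y₀ : M}
    (hh : MapsTo h K (extChartAt (𝓡 m) y₀).source) {ε : ℝ} (hε : 0 < ε) :
    ∃ V ∈ 𝓝 h, ∀ f ∈ V, ∀ g ∈ V, ∀ z ∈ K,
      ‖extChartAt (𝓡 m) y₀ (g z) - extChartAt (𝓡 m) y₀ (f z)‖ < ε := by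
  have hev : ∀ᶠ f : C(M, M) in 𝓝 h, ∀ z ∈ K,
      ‖extChartAt (𝓡 m) y₀ (f z) - extChartAt (𝓡 m) y₀ (h z)‖ < ε / 2 := by
    refine hK.eventually_forall_of_forall_eventually (P := fun (f : C(M, M)) z =>
      ‖extChartAt (𝓡 m) y₀ (f z) - extChartAt (𝓡 m) y₀ (h z)‖ < ε / 2) fun x hx => ?_
    have hc : ContinuousAt (extChartAt (𝓡 m) y₀) (h x) :=
      continuousAt_extChartAt' (by simpa using hh hx)
    have h1 : Continuous fun p : C(M, M) × M => p.1 p.2 := by fun_prop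
    have h2 : Continuous fun p : C(M, M) × M => h p.2 := by fun_prop
    have h3 : Filter.Tendsto (fun p : C(M, M) × M => ‖extChartAt (𝓡 m) y₀ (p.1 p.2) -
        extChartAt (𝓡 m) y₀ (h p.2)‖) (𝓝 (h, x)) (𝓝 0) := by
      have := (Filter.Tendsto.comp hc (h1.tendsto (h, x))).sub
        (Filter.Tendsto.comp hc (h2.tendsto (h, x)))
      simpa using this.norm
    exact h3.eventually_lt_const (half_pos hε)
  refine ⟨_, hev, fun f hf g hg z hz => ?_⟩
  rw [← sub_sub_sub_cancel_right _ _ (extChartAt (𝓡 m) y₀ (h z))]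
  exact (norm_sub_le _ _).trans_lt (by linarith [hf z hz, hg z hz])

variable [T2Space M] [IsManifold (𝓡 m) ∞ M]

theorem exists_adapted_bump (h : C(M, M)) (x : M) : ∃ (χ : M → ℝ) (r : ℝ),
    ContMDiff (𝓡 m) 𝓘(ℝ) ∞ χ ∧ χ =ᶠ[𝓝 x] 1 ∧ 0 < r ∧
    Metric.closedBall (extChartAt (𝓡 m) (h x) (h x)) r ⊆ (extChartAt (𝓡 m) (h x)).target ∧
    tsupport χ ⊆ (extChartAt (𝓡 m) x).source ∧
    MapsTo h (tsupport χ) (coordBall (h x) (extChartAt (𝓡 m) (h x) (h x)) r) := by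
  obtain ⟨r, hr, hcr⟩ := Metric.nhds_basis_closedBall.mem_iff.1
    ((isOpen_chart_target (h x)).mem_nhds (mem_extChartAt_target (I := 𝓡 m) (h x)))
  have hmem : h ⁻¹' coordBall (h x) (extChartAt (𝓡 m) (h x) (h x)) r ∈ 𝓝 x :=
    h.continuous.continuousAt.preimage_mem_nhds ((isOpen_coordBall _ _ _).mem_nhds
      ⟨mem_extChartAt_source (h x), Metric.mem_ball_self hr⟩)
  obtain ⟨χ, -, hχ⟩ := (SmoothBumpFunction.nhds_basis_tsupport (I := 𝓡 m) x).mem_iff.1 hmem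
  refine ⟨χ, r, χ.contMDiff, χ.eventuallyEq_one, hr, hcr, ?_, hχ⟩
  rw [extChartAt_source]
  exact χ.tsupport_subset_chartAt_source

variable [CompactSpace M]

/-- Balls are convex, so local constant approximations of the coordinates of `f` are glued by a
partition of unity. -/
theorem exists_contMDiff_near_coord {f : C(M, M)} {K : Set M} (hK : IsClosed K) {y₀ : M}
    (hf : MapsTo f K (extChartAt (𝓡 m) y₀).source) {ε : ℝ} (hε : 0 < ε) :
    ∃ s : M → EuclideanSpace ℝ (Fin m), ContMDiff (𝓡 m) 𝓘(ℝ, EuclideanSpace ℝ (Fin m)) ∞ s ∧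
      ∀ z ∈ K, ‖s z - extChartAt (𝓡 m) y₀ (f z)‖ < ε := by
  have hconv : ∀ z, Convex ℝ {v : EuclideanSpace ℝ (Fin m) |
      z ∈ K → v ∈ Metric.ball (extChartAt (𝓡 m) y₀ (f z)) ε} := fun z => by
    by_cases hz : z ∈ K
    · simp only [hz, true_imp_iff]
      exact convex_ball _ _
    · simpa [hz] using convex_univ
  have hloc : ∀ x, ∃ v : EuclideanSpace ℝ (Fin m), ∀ᶠ z in 𝓝 x,
      v ∈ {v | z ∈ K → v ∈ Metric.ball (extChartAt (𝓡 m) y₀ (f z)) ε} := fun x => by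
    by_cases hx : x ∈ K
    · refine ⟨extChartAt (𝓡 m) y₀ (f x), ?_⟩
      have hc : ContinuousAt (fun z => extChartAt (𝓡 m) y₀ (f z)) x :=
        ContinuousAt.comp (g := extChartAt (𝓡 m) y₀)
          (continuousAt_extChartAt' (by simpa using hf hx)) f.continuous.continuousAt
      filter_upwards [hc.preimage_mem_nhds (Metric.ball_mem_nhds _ hε)] with z hz _
      exact Metric.mem_ball_comm.1 hz
    · refine ⟨0, ?_⟩
      filter_upwards [hK.isOpen_compl.mem_nhds hx] with z hz hz'
      exact absurd hz' hz
  obtain ⟨s, hs⟩ := exists_contMDiffMap_forall_mem_convex_of_local_const (𝓡 m) (n := ⊤) hconv hloc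
  exact ⟨s, s.contMDiff, fun z hz => by simpa [dist_eq_norm] using hs z hz⟩

/-- Smooth maps are dense among continuous maps. -/
theorem exists_contMDiff_mem_nhds (h : C(M, M)) {U : Set C(M, M)} (hU : U ∈ 𝓝 h) :
    ∃ f ∈ U, ContMDiff (𝓡 m) (𝓡 m) ∞ f := by
  classical
  choose χ r hχ h1 hr hcr hχs hχh using exists_adapted_bump (m := m) h
  obtain ⟨t, ht⟩ := exists_finset_bump h1
  -- The statement is made for every neighbourhood `U`, since each inductive step must first find
  -- the smaller one from which a modification stays in `U`.
  suffices hind : ∀ t : Finset M, ∀ U ∈ 𝓝 h, ∃ f ∈ U, ∀ x ∈ t, ∀ z, χ x =ᶠ[𝓝 z] 1 →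
      ContMDiffAt (𝓡 m) (𝓡 m) ∞ f z by
    obtain ⟨f, hfU, hf⟩ := hind t U hU
    refine ⟨f, hfU, fun z => ?_⟩
    obtain ⟨x, hx, hxz⟩ := ht z
    exact hf x hx z hxz
  intro t
  induction t using Finset.induction_on with
  | empty => exact fun U hU => ⟨h, mem_of_mem_nhds hU, by simp⟩
  | insert x t _ ih =>
    intro U hU
    obtain ⟨V, hV, ε, hε, hstep⟩ := exists_local_modification h (hχ x) (hcr x) (hχh x) hU
    obtain ⟨f, hfV, hf⟩ := ih V hV
    obtain ⟨hfK, hstep⟩ := hstep f hfV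
    obtain ⟨s, hs, hsf⟩ := exists_contMDiff_near_coord (isClosed_tsupport (χ x))
      (fun z hz => (hfK hz).1) hε
    obtain ⟨f', hf'U, -, -, hold, hnew⟩ := hstep s (fun z _ => hs.contMDiffAt) hsf
    refine ⟨f', hf'U, fun y hy z hz => ?_⟩
    rcases Finset.mem_insert.1 hy with rfl | hy
    · exact hnew z hz
    · exact hold z (hf y hy z hz)

variable [RiemannianBundle (fun x : M => TangentSpace (𝓡 m) x)]
  [IsContMDiffRiemannianBundle (𝓡 m) ∞ (EuclideanSpace ℝ (Fin m))
      (fun x : M => TangentSpace (𝓡 m) x)]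
  [MeasurableSpace M] [BorelSpace M] {σ : SymplecticForm m M}

/-- `f` is turned into `g` by finitely many modifications, one per bump function, each inside one
coordinate ball and so leaving the pairing unchanged. -/
theorem exists_nhds_pairing_eq (hσ : IsCompatible σ) (h : C(M, M)) :
    ∃ U ∈ 𝓝 h, ∀ f ∈ U, ∀ g ∈ U, ContMDiff (𝓡 m) (𝓡 m) ∞ f → ContMDiff (𝓡 m) (𝓡 m) ∞ g →
      pairing σ f = pairing σ g := by
  classical
  choose χ r hχ h1 hr hcr hχs hχh using exists_adapted_bump (m := m) h
  obtain ⟨t, ht⟩ := exists_finset_bump h1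
  suffices hind : ∀ t : Finset M, ∀ U ∈ 𝓝 h, ∃ V ∈ 𝓝 h, ∀ f ∈ V, ∀ g ∈ V,
      ContMDiff (𝓡 m) (𝓡 m) ∞ f → ContMDiff (𝓡 m) (𝓡 m) ∞ g → ∃ f' ∈ U,
        ContMDiff (𝓡 m) (𝓡 m) ∞ f' ∧ pairing σ f = pairing σ f' ∧
        ∀ x ∈ t, ∀ z, χ x z = 1 → f' z = g z by
    obtain ⟨V, hV, hfg⟩ := hind t Set.univ Filter.univ_mem
    refine ⟨V, hV, fun f hf g hg hfs hgs => ?_⟩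
    obtain ⟨f', -, -, hff', hf'g⟩ := hfg f hf g hg hfs hgs
    rw [hff']
    congr 1
    ext z
    obtain ⟨x, hx, hxz⟩ := ht z
    exact hf'g x hx z hxz.eq_of_nhds
  intro t
  induction t using Finset.induction_on with
  | empty => exact fun U hU => ⟨U, hU, fun f hf g hg hfs hgs => ⟨f, hf, hfs, rfl, by simp⟩⟩
  | insert x t _ ih =>
    intro U hU
    obtain ⟨V, hV, ε, hε, hstep⟩ := exists_local_modification h (hχ x) (hcr x) (hχh x) hU
    obtain ⟨W, hW, hWε⟩ := eventually_norm_coord_sub_lt h (isClosed_tsupport (χ x)).isCompact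
      (fun z hz => (hχh x hz).1) hε
    obtain ⟨V', hV', hind⟩ := ih (V ∩ W) (Filter.inter_mem hV hW)
    refine ⟨V' ∩ (V ∩ W), Filter.inter_mem hV' (Filter.inter_mem hV hW),
      fun f hf g hg hfs hgs => ?_⟩
    obtain ⟨f', hf', hf's, hff', hf'g⟩ := hind f hf.1 g hg.1 hfs hgs
    obtain ⟨hf'K, hmod⟩ := hstep f' hf'.1
    have hgK := (hstep g hg.2.1).1
    -- The target coordinates are those of `g`, so that the new map equals `g` where the cut-off is
    -- 1.
    obtain ⟨f'', hf''U, hf'', hf''K, hold, -⟩ := hmod (fun z => extChartAt (𝓡 m) (h x) (g z))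
      (fun z hz => (contMDiffAt_chart (hgK hz).1).comp z hgs.contMDiffAt)
      (hWε f' hf'.2 g hg.2.2)
    have hf''s : ContMDiff (𝓡 m) (𝓡 m) ∞ f'' := fun z => hold z hf's.contMDiffAt
    have hoff : ∀ z, z ∉ tsupport (χ x) → f' z = f'' z := fun z hz => by
      rw [hf'', modify_of_eq_zero (image_eq_zero_of_notMem_tsupport hz)]
    refine ⟨f'', hf''U, hf''s, hff'.trans (pairing_eq_of_eqOn_compl hσ hf's hf''s (hr x) (hcr x)
      (isClosed_tsupport (χ x)).isCompact (hχs x) hf'K hf''K fun z hz => hoff z hz), ?_⟩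
    intro y hy z hz
    rcases Finset.mem_insert.1 hy with rfl | hy
    · have hzK : z ∈ tsupport (χ y) := subset_tsupport _ (by simp [hz])
      rw [hf'', modify_of_mem_source (hf'K hzK).1, hz, one_smul, add_sub_cancel,
        (extChartAt (𝓡 m) (h y)).left_inv (hgK hzK).1]
    -- Agreement with `g` obtained earlier survives, since moving towards `g` fixes points where the
    -- two maps already coincide.
    · have h2 := hf'g y hy z hz
      by_cases hzK : z ∈ tsupport (χ x)
      · rw [hf'', modify_of_mem_source (hf'K hzK).1, h2, sub_self, smul_zero, add_zero,
          (extChartAt (𝓡 m) (h x)).left_inv (hgK hzK).1]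
      · rw [← hoff z hzK, h2]

/-- The intermediate maps of the homotopy are only continuous. Each `h` is therefore given the
pairing of a smooth map `s h` near it; this defines a locally constant function on `C(M, M)` that
extends the pairing, hence is constant along the path of maps. -/
theorem pairing_eq_of_homotopic (hσ : IsCompatible σ) {f g : C(M, M)}
    (hf : ContMDiff (𝓡 m) (𝓡 m) ∞ f) (hg : ContMDiff (𝓡 m) (𝓡 m) ∞ g)
    (hfg : ContinuousMap.Homotopic f g) : pairing σ f = pairing σ g := by
  choose U hU hUeq using exists_nhds_pairing_eq hσ
  choose s hsU hs using fun h : C(M, M) => exists_contMDiff_mem_nhds (m := m) h (hU h)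
  have hloc : IsLocallyConstant fun h : C(M, M) => pairing σ (s h) := by
    refine (IsLocallyConstant.iff_eventually_eq _).2 fun h => ?_
    filter_upwards [eventually_mem_nhds_iff.2 (hU h)] with h' hh'
    -- A smooth map in both `U h` and `U h'` compares the two choices.
    obtain ⟨k, hk, hks⟩ := exists_contMDiff_mem_nhds (m := m) h' (Filter.inter_mem (hU h') hh')
    rw [hUeq h' (s h') (hsU h') k hk.1 (hs h') hks, hUeq h k hk.2 (s h) (hsU h) hks (hs h)]
  have hself : ∀ h : C(M, M), ContMDiff (𝓡 m) (𝓡 m) ∞ h → pairing σ (s h) = pairing σ h :=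
    fun h hh => hUeq h (s h) (hsU h) h (mem_of_mem_nhds (hU h)) (hs h) hh
  obtain ⟨H⟩ := hfg
  have h01 := (hloc.comp_continuous H.curry.continuous).apply_eq_of_preconnectedSpace 0 1
  have e0 : H.curry 0 = f := by ext z; simp
  have e1 : H.curry 1 = g := by ext z; simp
  simp only [Function.comp, e0, e1] at h01
  rw [← hself f hf, ← hself g hg, h01]

/-- A smooth map that preserves the symplectic form minimizes the energy in its homotopy class. -/
theorem minimizesInHomotopyClass_of_formPullback_eq (hσ : IsCompatible σ)
    (φ : C^∞⟮𝓡 m, M; 𝓡 m, M⟯) (hφ : formPullback (m := m) φ σ.form = σ.form) :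
    MinimizesInHomotopyClass σ φ := by
  intro ψ hφψ
  have hpair : pairing σ φ = pairing σ ψ :=
    pairing_eq_of_homotopic hσ (f := (φ : C(M, M))) (g := (ψ : C(M, M))) φ.contMDiff ψ.contMDiff hφψ
  have hle := two_mul_pairing_sub_le (σ := σ) (f := ψ) ψ.contMDiff
  have hφσ := pairing_of_formPullback_eq hφ
  have hφe : energy (m := m) σ φ =
      (1 / 2) * ∫ x, normSqTwoForm (σ.form x) ∂(riemannianVolume m M) :=
    congrArg (fun α : FormField m 2 M =>
      (1 / 2) * ∫ x, normSqTwoForm (α x) ∂(riemannianVolume m M)) hφ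
  rw [hφe]
  refine mul_le_mul_of_nonneg_left ?_ (by norm_num)
  -- 2P(ψ) - ∫|σ|² ≤ ∫|ψ^*σ|² with P(ψ) = P(φ) = ∫|σ|².
  linarith only [hle, hpair, hφσ]

end Homotopy

end SymplecticEnergy

end

theorem mainTheorem9 {m : ℕ} {M : Type*} [TopologicalSpace M] [T2Space M] [CompactSpace M]
    [ChartedSpace (EuclideanSpace ℝ (Fin m)) M] [IsManifold (𝓡 m) ∞ M]
    [MeasurableSpace M] [BorelSpace M]
    [RiemannianBundle (fun x : M => TangentSpace (𝓡 m) x)]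
    [IsContMDiffRiemannianBundle (𝓡 m) ∞ (EuclideanSpace ℝ (Fin m))
      (fun x : M => TangentSpace (𝓡 m) x)]
    (σ : SymplecticEnergy.SymplecticForm m M) (hσ : SymplecticEnergy.IsCompatible σ) :
    SymplecticEnergy.MinimizesInHomotopyClass σ (ContMDiffMap.id : C^∞⟮𝓡 m, M; 𝓡 m, M⟯) ∧
      ∀ φ : M ≃ₘ^∞⟮𝓡 m, 𝓡 m⟯ M, SymplecticEnergy.IsSymplectomorphism σ φ →
        SymplecticEnergy.MinimizesInHomotopyClass σ (φ : C^∞⟮𝓡 m, M; 𝓡 m, M⟯) := by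
  refine ⟨SymplecticEnergy.minimizesInHomotopyClass_of_formPullback_eq hσ _ ?_, fun φ hφ =>
    SymplecticEnergy.minimizesInHomotopyClass_of_formPullback_eq hσ _ hφ⟩
  funext x
  ext v
  refine congrArg (σ.form x) (funext fun i => ?_)
  exact congrArg (fun L : TangentSpace (𝓡 m) x →L[ℝ] TangentSpace (𝓡 m) x => L (v i))
    (mfderiv_id (I := 𝓡 m) (x := x))
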